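/- Let $R\subset V^*$ be a finite irreducible reduced crystallographic root system with simple roots $\alpha_i$ ($i\in I$), highest root $\theta$, Weyl group $W$ (generated by the simple reflections $s_i$) acting on $V$, and coroot lattice $Q^\vee\subset V$. Let $r_\theta\in W$ be the reflection in $\theta$. Let $\widetilde W$ be the affine Weyl group, generated by the reflections of $V$ in the hyperplanes $H_\alpha^k=\{v:\langle v,\alpha\rangle=-k\}$ ($\alpha\in R$, $k\in\mathbb Z$). Every $x\in\widetilde W$ is uniquely $x=wt_\lambda: v\mapsto w(v+\lambda)$ with $w\in W$, $\lambda\in Q^\vee$; put $\pi(wt_\lambda)=w$. Let $A^\circ=\{v:\langle v,\alpha_i\rangle>0\ (i\in I),\ \langle v,\theta\rangle<1\}$ be the fundamental alcove, $A_x=x^{-1}A^\circ$, and $r=|I|+1$. The delayed affine Grassmannian random walk is the Markov chain $(\widetilde Y_0,\widetilde Y_1,\dots)$ on $\widetilde W$ (identified with the set of alcoves by $x\mapsto A_x$) with $\widetilde Y_0=\mathrm{id}$ and the following transitions. From $x$ it moves with probability $1/r$ to each $y$ such that $A_y$ is adjacent to $A_x$ (i.e. separated from $A_x$ by exactly one hyperplane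 $H_\alpha^k$), the hyperplane separating $A_x$ from $A_y$ does not separate $A_x$ from $A^\circ$, and $A_y$ lies in the fundamental Weyl chamber $\{v:\langle v,\alpha_i\rangle>0\ (i\in I)\}$; with the remaining probability it stays at $x$. For $w,v\in W$ let $$p_{w,v}=\begin{cases}1/r&\text{if } v=s_iw<w \text{ for some } i\in I,\\ 1/r&\text{if } v=r_\theta w>w,\\ k_w/r&\text{if } v=w,\\ 0&\text{otherwise,}\end{cases}$$ where $<$ is the Bruhat order on $W$ and $k_w$ is chosen so that $\sum_{v\in W}p_{w,v}=1$. **Proposition.** Both transition matrices are stochastic (non-negative entries, row sums $1$), and the projection $(\pi(\widetilde Y_0),\pi(\widetilde Y_1),\dots)$ is the Markov chain on $W$ with initial state $\mathrm{id}$ and transition matrix $P=(p_{w,v})$. -/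

import Mathlib

open MeasureTheory

noncomputable section

namespace AffWalk

variable {ι M N : Type*} [AddCommGroup M] [Module ℝ M] [AddCommGroup N] [Module ℝ N]

/-! ### The finite and the affine Weyl group

Roots live in `M`, coroots in `N`, and `N` is the space `V` on which the groups act;
`P.toLinearMap (P.root i) v` is the value `⟨v, α_i⟩` of the root `α_i` at `v`. -/

/-- The Weyl group `W`, as the group of linear transformations of `V` generated by the
reflections `v ↦ v - ⟨v, α⟩ α^∨`. -/
def weyl (P : RootPairing ι ℝ M N) : Subgroup (N ≃ₗ[ℝ] N) :=
  Subgroup.closure (Set.range P.coreflection)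

/-- The linear reflection `r_α`, as an element of `W`. -/
def refl (P : RootPairing ι ℝ M N) (i : ι) : weyl P :=
  ⟨P.coreflection i, Subgroup.subset_closure ⟨i, rfl⟩⟩

/-- The affine hyperplane `H_α^k = {v | ⟨v, α⟩ = -k}`. -/
def hyperplane (P : RootPairing ι ℝ M N) (i : ι) (k : ℤ) : Set N :=
  {v | P.toLinearMap (P.root i) v = -(k : ℝ)}

/-- The affine reflection `v ↦ v - (⟨v, α⟩ + k) α^∨` in the hyperplane `H_α^k`. -/
def affineRefl (P : RootPairing ι ℝ M N) (i : ι) (k : ℤ) : N ≃ᵃ[ℝ] N :=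
  (P.coreflection i).toAffineEquiv.trans
    (AffineEquiv.constVAdd ℝ N (-((k : ℝ) • P.coroot i)))

lemma affineRefl_apply (P : RootPairing ι ℝ M N) (i : ι) (k : ℤ) (v : N) :
    affineRefl P i k v = v - (P.toLinearMap (P.root i) v + k) • P.coroot i := by
  simp [affineRefl, RootPairing.coreflection_apply, add_smul]
  abel

/-- The affine Weyl group, as the group of affine transformations of `V` generated by the
reflections in all the hyperplanes `H_α^k`. -/
def affineWeyl (P : RootPairing ι ℝ M N) : Subgroup (N ≃ᵃ[ℝ] N) :=
  Subgroup.closure {g | ∃ (i : ι) (k : ℤ), g = affineRefl P i k}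

lemma linear_mem_weyl (P : RootPairing ι ℝ M N) (x : affineWeyl P) :
    AffineEquiv.linearHom (x : N ≃ᵃ[ℝ] N) ∈ weyl P := by
  have h : affineWeyl P ≤ (weyl P).comap AffineEquiv.linearHom := by
    rw [affineWeyl, Subgroup.closure_le]
    rintro _ ⟨i, k, rfl⟩
    have : AffineEquiv.linearHom (affineRefl P i k) = P.coreflection i := by
      ext v
      rfl
    change AffineEquiv.linearHom (affineRefl P i k) ∈ weyl P
    rw [this]
    exact Subgroup.subset_closure ⟨i, rfl⟩
  exact h x.2

/-- The projection `π` of the affine Weyl group onto `W`, that is, the linear part. It sends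
`w t_λ : v ↦ w (v + λ)` to `w` (see `apply_eq_proj`). -/
def proj (P : RootPairing ι ℝ M N) : affineWeyl P →* weyl P :=
  (AffineEquiv.linearHom.comp (affineWeyl P).subtype).codRestrict (weyl P) (linear_mem_weyl P)

/-- The coroot lattice `Q^∨`. -/
def corootLattice (P : RootPairing ι ℝ M N) : AddSubgroup N :=
  AddSubgroup.closure (Set.range P.coroot)

lemma apply_mem_corootLattice (P : RootPairing ι ℝ M N) [P.IsCrystallographic]
    (x : affineWeyl P) :
    ∀ v ∈ corootLattice P, (x : N ≃ᵃ[ℝ] N) v ∈ corootLattice P := by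
  have hr : ∀ i (k : ℤ), ∀ v ∈ corootLattice P, affineRefl P i k v ∈ corootLattice P := by
    intro i k v hv
    have hz : ∃ z : ℤ, P.toLinearMap (P.root i) v = z := by
      induction hv using AddSubgroup.closure_induction with
      | mem y hy =>
        obtain ⟨j, rfl⟩ := hy
        obtain ⟨z, hz⟩ := P.exists_value (S := ℤ) i j
        exact ⟨z, by simpa using hz.symm⟩
      | zero => exact ⟨0, by simp⟩
      | add y y' _ _ h h' =>
        obtain ⟨z, h⟩ := h
        obtain ⟨z', h'⟩ := h'
        exact ⟨z + z', by simp [h, h']⟩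
      | neg y _ h =>
        obtain ⟨z, h⟩ := h
        exact ⟨-z, by simp [h]⟩
    obtain ⟨z, hz⟩ := hz
    rw [affineRefl_apply, hz]
    have : ((z : ℝ) + k) • P.coroot i = (z + k) • P.coroot i := by
      rw [← Int.cast_smul_eq_zsmul ℝ]; push_cast; rfl
    rw [this]
    exact sub_mem hv (zsmul_mem (AddSubgroup.subset_closure (Set.mem_range_self i)) _)
  have hinv : ∀ i (k : ℤ), (affineRefl P i k)⁻¹ = affineRefl P i k := by
    intro i k
    rw [inv_eq_iff_mul_eq_one]
    ext v
    simp only [AffineEquiv.coe_mul, Function.comp_apply, affineRefl_apply, AffineEquiv.coe_one,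
      id_eq, map_sub, map_smul, RootPairing.root_coroot_eq_pairing, RootPairing.pairing_same,
      smul_eq_mul]
    module
  obtain ⟨x, hx⟩ := x
  change ∀ v ∈ corootLattice P, x v ∈ corootLattice P
  induction hx using Subgroup.closure_induction'' with
  | one => intro v hv; simpa using hv
  | mem y hy => obtain ⟨i, k, rfl⟩ := hy; exact hr i k
  | inv_mem y hy => obtain ⟨i, k, rfl⟩ := hy; rw [hinv]; exact hr i k
  | mul y z _ _ h h' => intro v hv; exact h _ (h' v hv)

/-- Every element `x` of the affine Weyl group is `w t_λ` with `w = π x` and `λ ∈ Q^∨`. -/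
lemma apply_eq_proj (P : RootPairing ι ℝ M N) [P.IsCrystallographic] (x : affineWeyl P) :
    ∃ l ∈ corootLattice P, ∀ v, (x : N ≃ᵃ[ℝ] N) v = (proj P x : N ≃ₗ[ℝ] N) (v + l) := by
  have hlin : ∀ v, (proj P x : N ≃ₗ[ℝ] N) v = (x : N ≃ᵃ[ℝ] N).linear v := fun _ ↦ rfl
  have hx : ∀ v, (x : N ≃ᵃ[ℝ] N) v = (x : N ≃ᵃ[ℝ] N).linear v + (x : N ≃ᵃ[ℝ] N) 0 := by
    intro v
    simpa using (x : N ≃ᵃ[ℝ] N).map_vadd 0 v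
  refine ⟨-((x⁻¹ : affineWeyl P) : N ≃ᵃ[ℝ] N) 0,
    neg_mem (apply_mem_corootLattice P x⁻¹ 0 (zero_mem _)), fun v ↦ ?_⟩
  have h0 : (x : N ≃ᵃ[ℝ] N) (((x⁻¹ : affineWeyl P) : N ≃ᵃ[ℝ] N) 0) = 0 := by
    rw [Subgroup.coe_inv]
    exact (x : N ≃ᵃ[ℝ] N).apply_symm_apply 0
  rw [hx] at h0
  rw [hlin, hx v, map_add, map_neg, add_right_inj]
  exact (neg_eq_of_add_eq_zero_right h0).symm

/-! ### Length and Bruhat order on `W` -/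

/-- The length of `w ∈ W`: the least length of a word in the simple reflections with
product `w`. -/
def length {P : RootPairing ι ℝ M N} (b : P.Base) (w : weyl P) : ℕ :=
  sInf {n | ∃ l : List b.support, l.length = n ∧ (l.map fun i ↦ refl P i).prod = w}

/-- The strict Bruhat order on `W`: the transitive closure of `u < r_α u` whenever
`α` is a root and `ℓ(u) < ℓ(r_α u)`. -/
def BruhatLT {P : RootPairing ι ℝ M N} (b : P.Base) : weyl P → weyl P → Prop :=
  Relation.TransGen fun u v ↦ ∃ i : ι, v = refl P i * u ∧ length b u < length b v

/-- `θ` is (the index of) the highest root: `θ - α` is a sum of simple roots for every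
root `α`. -/
def IsHighestRoot {P : RootPairing ι ℝ M N} (b : P.Base) (θ : ι) : Prop :=
  ∀ i, P.root θ - P.root i ∈ AddSubmonoid.closure (P.root '' b.support)

/-! ### Alcoves -/

/-- The fundamental alcove `A°`, bounded by the hyperplanes of the simple affine roots
`α_i` and `δ - θ`. -/
def fundAlcove {P : RootPairing ι ℝ M N} (b : P.Base) (θ : ι) : Set N :=
  {v | (∀ i ∈ b.support, 0 < P.toLinearMap (P.root i) v) ∧ P.toLinearMap (P.root θ) v < 1}

/-- The fundamental Weyl chamber. -/
def fundChamber {P : RootPairing ι ℝ M N} (b : P.Base) : Set N :=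
  {v | ∀ i ∈ b.support, 0 < P.toLinearMap (P.root i) v}

/-- The alcove `A_x = x⁻¹ A°` labelled by `x`. With this convention `A_{s x}` and `A_x` are
adjacent for every simple reflection `s`, and `A_{t_λ} = A° - λ`. -/
def alcove {P : RootPairing ι ℝ M N} (b : P.Base) (θ : ι) (x : affineWeyl P) : Set N :=
  (x : N ≃ᵃ[ℝ] N) ⁻¹' fundAlcove b θ

/-- The hyperplanes `H_α^k` that separate `A` from `B`. (The pairs `(α, k)` and `(-α, -k)`
give the same hyperplane with the two sides exchanged, so this is symmetric in `A`, `B`.) -/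
def separating (P : RootPairing ι ℝ M N) (A B : Set N) : Set (Set N) :=
  {H | ∃ (i : ι) (k : ℤ), H = hyperplane P i k ∧
    (∀ v ∈ A, 0 < P.toLinearMap (P.root i) v + k) ∧
    (∀ v ∈ B, P.toLinearMap (P.root i) v + k < 0)}

/-! ### The two chains -/

/-- A possible transition `A_x → A_y` of the reduced affine Grassmannian random walk: `A_x` and
`A_y` are adjacent, i.e. separated by exactly one hyperplane `H` of the arrangement; `H` does
not separate `A_x` from `A°`, i.e. has not been crossed yet; and `A_y` lies in the
fundamental chamber. -/
def GrassStep {P : RootPairing ι ℝ M N} (b : P.Base) (θ : ι) (x y : affineWeyl P) : Prop :=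
  ∃ H, separating P (alcove b θ x) (alcove b θ y) = {H} ∧
    H ∉ separating P (fundAlcove b θ) (alcove b θ x) ∧
    alcove b θ y ⊆ fundChamber b

/-- A possible non-trivial transition `w → v` of the chain on `W`: either `v = s_i w < w` for
some simple reflection `s_i`, or `v = r_θ w > w`. -/
def WeylStep {P : RootPairing ι ℝ M N} (b : P.Base) (θ : ι) (w v : weyl P) : Prop :=
  (∃ i ∈ b.support, v = refl P i * w ∧ BruhatLT b v w) ∨
    (v = refl P θ * w ∧ BruhatLT b w v)

open Classical in
/-- The transition matrix in which every allowed transition to a different state has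
probability `1 / r`, and the chain stays where it is with the remaining probability. -/
def delayedMatrix {S : Type*} (r : ℕ) (step : S → S → Prop) (x y : S) : ℝ :=
  if y = x then 1 - ({z | z ≠ x ∧ step x z}.ncard : ℝ) / r
  else if step x y then 1 / r else 0

/-- The transition matrix of the delayed affine Grassmannian random walk; here
`r = |I| + 1` is the rank of the affine Weyl group. -/
def grassMatrix {P : RootPairing ι ℝ M N} (b : P.Base) (θ : ι) :
    affineWeyl P → affineWeyl P → ℝ :=
  delayedMatrix (b.support.card + 1) (GrassStep b θ)

/-- The transition matrix `(p_{w,v})` of the chain on `W`. -/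
def weylMatrix {P : RootPairing ι ℝ M N} (b : P.Base) (θ : ι) : weyl P → weyl P → ℝ :=
  delayedMatrix (b.support.card + 1) (WeylStep b θ)

/-- `p` has non-negative entries and row sums one. -/
def IsStochastic {S : Type*} (p : S → S → ℝ) : Prop :=
  (∀ x y, 0 ≤ p x y) ∧ ∀ x, HasSum (p x) 1

/-- `X` is a Markov chain on the discrete space `S` with initial state `x₀` and transition
matrix `p`: for every path `a₀, …, a_{n+1}`, the conditional probability of `X_{n+1} = a_{n+1}`
given `X₀ = a₀, …, X_n = a_n` is `p a_n a_{n+1}` (stated without division, so that nothing is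
claimed when the condition has probability zero). -/
structure IsMarkovChain {S Ω : Type*} [MeasurableSpace Ω] (μ : Measure Ω) (X : ℕ → Ω → S)
    (x₀ : S) (p : S → S → ℝ) : Prop where
  measurable : ∀ n, @Measurable Ω S _ ⊤ (X n)
  init : ∀ᵐ ω ∂μ, X 0 ω = x₀
  step : ∀ (n : ℕ) (a : ℕ → S),
    μ.real {ω | ∀ j ≤ n + 1, X j ω = a j} =
      μ.real {ω | ∀ j ≤ n, X j ω = a j} * p (a n) (a (n + 1))

end AffWalk

end

/-! The projection is a lumping: the steps from an alcove `A_x` in the fundamental chamber depend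
only on `π x`. The alcoves adjacent to `A_x` are the `A_{s x}` with `s` the reflection in a simple
affine root `a` (some `α_i`, or `1 - θ`), and the wall crossed is the zero set of `a ∘ x`. This is
an affine root `β + k`, positive on `A_x`, whose gradient `β` is the gradient of `a` composed with
`π x`.

If `β` is negative on the chamber, then `k > 0`, so `a ∘ x` is positive on `A°` too: the wall has
not been crossed, and since it misses the origin, crossing it does not leave the chamber. If `β` is
positive and the new alcove is in the chamber, then `k < 0`, and the wall already separates `A°`
from `A_x`. So the steps are the `a` with `β` negative (`grassStep_iff`). For `w = π x`, negativity
of `β` means `s_i w < w` when `a = α_i` and `r_θ w > w` when `a = 1 - θ`, so `W` obeys the same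
criterion (`weylStep_iff`). Hence `π` maps steps bijectively to steps (`bijOn_proj`). All steps have
probability `1 / r`, so the holding probabilities agree as well, and a general lumping theorem
(`IsMarkovChain.map`) applies on the absorbing set of alcoves in the chamber.

The geometry rests on two facts: a simple affine reflection keeps all positive affine roots but its
own positive (`affRoot_affReflection_pos`), and the affine Weyl group acts freely on alcoves
(`eq_one_of_apply_mem_fundAlcove`). Signs of roots are read off at a point `v` of the chamber or
alcove. -/

namespace AffWalk

/-! ### Values of roots on the fundamental chamber -/

section RootValues

variable {ι M N : Type*} [AddCommGroup M] [Module ℝ M] [AddCommGroup N] [Module ℝ N]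
  {P : RootPairing ι ℝ M N} {b : P.Base} {θ : ι} {v : N}

lemma root'_reflectionPerm (i j : ι) (v : N) :
    P.root' (P.reflectionPerm j i) v = P.root' i v - P.pairing i j * P.root' j v := by
  simp [RootPairing.root', RootPairing.reflection_apply]

lemma root'_coreflection (i j : ι) (v : N) :
    P.root' i (P.coreflection j v) = P.root' (P.reflectionPerm j i) v := by
  rw [root'_reflectionPerm, RootPairing.coreflection_apply]
  simp [mul_comm]

lemma root'_reflectionPerm_self (i : ι) (v : N) :
    P.root' (P.reflectionPerm i i) v = -P.root' i v := by
  rw [root'_reflectionPerm, RootPairing.pairing_same]; ring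

lemma reflectionPerm_self_self (i : ι) :
    P.reflectionPerm (P.reflectionPerm i i) (P.reflectionPerm i i) = i := by
  let := P.indexNeg
  exact neg_neg i

lemma coreflection_reflectionPerm_self (i : ι) :
    P.coreflection (P.reflectionPerm i i) = P.coreflection i := by
  ext v
  have h : P.coroot (P.reflectionPerm i i) = -P.coroot i := by simp
  rw [RootPairing.coreflection_apply, RootPairing.coreflection_apply, root'_reflectionPerm_self, h,
    neg_smul_neg]

variable [Finite ι] [P.IsCrystallographic]

lemma root'_pos_of_isPos {i : ι} (hi : b.IsPos i) (hv : v ∈ fundChamber b) :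
    0 < P.root' i v := by
  refine hi.induction_on_add (p := fun i ↦ 0 < P.root' i v) hv fun i j k hk hi hj ↦ ?_
  rw [RootPairing.root', hk, map_add]
  exact add_pos hi (hv j hj)

lemma isPos_iff_root'_pos (hv : v ∈ fundChamber b) {i : ι} : b.IsPos i ↔ 0 < P.root' i v := by
  refine ⟨fun h ↦ root'_pos_of_isPos h hv, fun h ↦ ?_⟩
  refine (RootPairing.Base.IsPos.or_neg b i).resolve_right fun hn ↦ ?_
  have := root'_pos_of_isPos hn hv
  rw [show (P.indexNeg.neg i) = P.reflectionPerm i i from rfl, root'_reflectionPerm_self] at this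
  linarith

lemma root'_ne_zero (hv : v ∈ fundChamber b) (i : ι) : P.root' i v ≠ 0 := by
  rcases RootPairing.Base.IsPos.or_neg b i with h | h
  · exact (root'_pos_of_isPos h hv).ne'
  · have := root'_pos_of_isPos h hv
    rw [show (P.indexNeg.neg i) = P.reflectionPerm i i from rfl, root'_reflectionPerm_self] at this
    linarith

lemma root'_reflectionPerm_pos [P.IsReduced] (hv : v ∈ fundChamber b) {i j : ι}
    (hi : 0 < P.root' i v) (hj : j ∈ b.support) (hij : i ≠ j) :
    0 < P.root' (P.reflectionPerm j i) v :=
  root'_pos_of_isPos (((isPos_iff_root'_pos hv).2 hi).reflectionPerm hj hij) hv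

omit [Finite ι] [P.IsCrystallographic] in
lemma eq_zero_or_pos_of_mem_closure (hv : v ∈ fundChamber b) {x : M}
    (hx : x ∈ AddSubmonoid.closure (P.root '' b.support)) : x = 0 ∨ 0 < P.toLinearMap x v := by
  induction hx using AddSubmonoid.closure_induction with
  | mem y hy => obtain ⟨j, hj, rfl⟩ := hy; exact .inr (hv j hj)
  | zero => exact .inl rfl
  | add y z _ _ hy hz =>
    rcases hy with rfl | hy
    · simpa using hz
    · rcases hz with rfl | hz
      · simpa using Or.inr hy
      · right; rw [map_add]; exact add_pos hy hz

omit [Finite ι] [P.IsCrystallographic] in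
lemma IsHighestRoot.root'_lt (hθ : IsHighestRoot b θ) (hv : v ∈ fundChamber b) {i : ι}
    (hi : i ≠ θ) : P.root' i v < P.root' θ v := by
  rcases eq_zero_or_pos_of_mem_closure hv (hθ i) with h | h
  · exact absurd (P.root.injective (sub_eq_zero.1 h)).symm hi
  · simpa using h

omit [Finite ι] [P.IsCrystallographic] in
lemma IsHighestRoot.root'_pos (hθ : IsHighestRoot b θ) (hv : v ∈ fundChamber b) :
    0 < P.root' θ v := by
  -- Compare `θ` with the root `-θ`.
  have h := hθ.root'_lt hv (i := P.reflectionPerm θ θ) (P.ne_neg θ).symm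
  rw [root'_reflectionPerm_self] at h
  linarith

omit [Finite ι] [P.IsCrystallographic] in
lemma IsHighestRoot.root'_le (hθ : IsHighestRoot b θ) (hv : v ∈ fundChamber b) (i : ι) :
    P.root' i v ≤ P.root' θ v := by
  rcases eq_or_ne i θ with rfl | h
  · exact le_rfl
  · exact (hθ.root'_lt hv h).le

omit [Finite ι] [P.IsCrystallographic] in
lemma IsHighestRoot.neg_root'_le (hθ : IsHighestRoot b θ) (hv : v ∈ fundChamber b) (i : ι) :
    -P.root' i v ≤ P.root' θ v := by
  rw [← root'_reflectionPerm_self]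
  exact hθ.root'_le hv _

omit [Finite ι] in
-- With `n = ⟨α_i, θ^∨⟩`, the root `α_i - nθ` takes at `v` a value between `-θ(v)` and `θ(v)`. As `0
-- < α_i(v) < θ(v)`, this excludes `n ≤ -1` and `n ≥ 2`.
lemma IsHighestRoot.pairing_eq_zero_or_one (hθ : IsHighestRoot b θ) (hv : v ∈ fundChamber b)
    {i : ι} (hi : 0 < P.root' i v) (hiθ : i ≠ θ) : P.pairing i θ = 0 ∨ P.pairing i θ = 1 := by
  obtain ⟨z, hz⟩ := P.exists_value (S := ℤ) i θ
  replace hz : P.pairing i θ = z := by simpa using hz.symm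
  have h1 := hθ.root'_le hv (P.reflectionPerm θ i)
  have h2 := hθ.neg_root'_le hv (P.reflectionPerm θ i)
  have h3 := hθ.root'_lt hv hiθ
  have h4 := hθ.root'_pos hv
  rw [root'_reflectionPerm, hz] at h1 h2
  have h5 : (-1 : ℝ) < z := by
    by_contra! h
    nlinarith
  have h6 : (z : ℝ) < 2 := by
    by_contra! h
    nlinarith
  rw [hz]
  norm_cast at *
  omega

omit [Finite ι] [P.IsCrystallographic] in
lemma exists_mem_fundAlcove [P.IsRootSystem] (hθ : IsHighestRoot b θ) :
    (fundAlcove b θ).Nonempty := by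
  obtain ⟨v, hv⟩ := (P.flip.toPerfPair).surjective (b.toWeightBasis.constr ℝ fun _ ↦ (1 : ℝ))
  have hval : ∀ i ∈ b.support, P.root' i v = 1 := fun i hi ↦ by
    have := b.toWeightBasis.constr_basis ℝ (fun _ ↦ (1 : ℝ)) ⟨i, hi⟩
    rw [← hv] at this
    simpa using this
  have hc : v ∈ fundChamber b := fun i hi ↦ by
    change 0 < P.root' i v
    rw [hval i hi]; exact one_pos
  have hp := hθ.root'_pos hc
  -- All simple roots are `1` at `v`; the scaling makes the value of `θ` equal to `1/2`.
  refine ⟨(2 * P.root' θ v)⁻¹ • v, fun i hi ↦ ?_, ?_⟩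
  · rw [map_smul]
    have := hc i hi
    exact smul_pos (by positivity) this
  · rw [map_smul, smul_eq_mul, mul_inv, mul_assoc, inv_mul_cancel₀ hp.ne']
    norm_num

omit [Finite ι] [P.IsCrystallographic] in
lemma IsHighestRoot.abs_root'_lt_one (hθ : IsHighestRoot b θ) (hv : v ∈ fundAlcove b θ) (i : ι) :
    |P.root' i v| < 1 :=
  (abs_le'.2 ⟨hθ.root'_le hv.1 i, hθ.neg_root'_le hv.1 i⟩).trans_lt hv.2

end RootValues

end AffWalk

namespace AffWalk

/-! ### Affine roots and their signs on the fundamental alcove -/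

section AffineRoots

variable {ι M N : Type*} [AddCommGroup M] [Module ℝ M] [AddCommGroup N] [Module ℝ N]

/-- The affine root `α_i + k`, evaluated at a point. -/
def affRoot (P : RootPairing ι ℝ M N) (a : ι × ℤ) (v : N) : ℝ := P.root' a.1 v + a.2

/-- The simple affine roots `α_i` and `1 - θ`. -/
def IsSimpleAff {P : RootPairing ι ℝ M N} (b : P.Base) (θ : ι) (a : ι × ℤ) : Prop :=
  (a.1 ∈ b.support ∧ a.2 = 0) ∨ a = (P.reflectionPerm θ θ, 1)

/-- An affine reflection, as an element of the affine Weyl group. -/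
def affReflection (P : RootPairing ι ℝ M N) (a : ι × ℤ) : affineWeyl P :=
  ⟨affineRefl P a.1 a.2, Subgroup.subset_closure ⟨a.1, a.2, rfl⟩⟩

variable {P : RootPairing ι ℝ M N} {b : P.Base} {θ : ι} {v : N}

lemma coe_affReflection_apply (a : ι × ℤ) (v : N) :
    (affReflection P a : N ≃ᵃ[ℝ] N) v = v - affRoot P a v • P.coroot a.1 :=
  affineRefl_apply P a.1 a.2 v

lemma root'_affReflection (i : ι) (a : ι × ℤ) (v : N) :
    P.root' i ((affReflection P a : N ≃ᵃ[ℝ] N) v) =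
      P.root' i v - affRoot P a v * P.pairing i a.1 := by
  rw [coe_affReflection_apply, map_sub, map_smul, RootPairing.root'_coroot_eq_pairing, smul_eq_mul]

lemma affRoot_affReflection_self (a : ι × ℤ) (v : N) :
    affRoot P a ((affReflection P a : N ≃ᵃ[ℝ] N) v) = -affRoot P a v := by
  rw [affRoot, root'_affReflection, RootPairing.pairing_same, affRoot]; ring

lemma affReflection_mul_self (a : ι × ℤ) : affReflection P a * affReflection P a = 1 := by
  ext v
  rw [Subgroup.coe_mul, AffineEquiv.mul_def, AffineEquiv.trans_apply, coe_affReflection_apply,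
    affRoot_affReflection_self, coe_affReflection_apply]
  simp

lemma affReflection_inv (a : ι × ℤ) : (affReflection P a)⁻¹ = affReflection P a :=
  inv_eq_of_mul_eq_one_left (affReflection_mul_self a)

lemma refl_mul_self (i : ι) : refl P i * refl P i = 1 := by
  ext v
  exact P.coreflection_same i v

lemma proj_affReflection (a : ι × ℤ) : proj P (affReflection P a) = refl P a.1 := by
  ext v
  rfl

lemma affRoot_combo (a : ι × ℤ) (u v : N) (t : ℝ) :
    affRoot P a ((1 - t) • u + t • v) = (1 - t) * affRoot P a u + t * affRoot P a v := by
  rw [affRoot, affRoot, affRoot, map_add, map_smul, map_smul, smul_eq_mul, smul_eq_mul]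
  ring

lemma mem_fundAlcove_iff : v ∈ fundAlcove b θ ↔ ∀ a, IsSimpleAff b θ a → 0 < affRoot P a v := by
  constructor
  · rintro ⟨h1, h2⟩ ⟨i, k⟩ (⟨hi, hk⟩ | h)
    · dsimp only at hi hk
      simpa [affRoot, hk] using h1 i hi
    · rw [h, affRoot, root'_reflectionPerm_self]
      have : P.root' θ v < 1 := h2
      push_cast
      linarith
  · intro h
    refine ⟨fun i hi ↦ by simpa [affRoot] using h (i, 0) (.inl ⟨hi, rfl⟩), ?_⟩
    have := h _ (.inr rfl)
    rw [affRoot, root'_reflectionPerm_self] at this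
    change P.root' θ v < 1
    push_cast at this
    linarith

lemma affRoot_neg (i : ι) (k : ℤ) (v : N) :
    affRoot P (P.reflectionPerm i i, -k) v = -affRoot P (i, k) v := by
  rw [affRoot, affRoot, root'_reflectionPerm_self]
  push_cast
  ring

/-- The constant term changes by an integer multiple of a pairing, which is an integer in the
crystallographic case. -/
lemma exists_affRoot_affReflection [P.IsCrystallographic] (a c : ι × ℤ) :
    ∃ a', ∀ v, affRoot P a ((affReflection P c : N ≃ᵃ[ℝ] N) v) = affRoot P a' v := by
  obtain ⟨z, hz⟩ := P.exists_value (S := ℤ) a.1 c.1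
  replace hz : P.pairing a.1 c.1 = z := by simpa using hz.symm
  refine ⟨(P.reflectionPerm c.1 a.1, a.2 - c.2 * z), fun v ↦ ?_⟩
  rw [affRoot, root'_affReflection, affRoot, affRoot, root'_reflectionPerm, hz]
  push_cast
  ring

lemma exists_affRoot_apply [P.IsCrystallographic] (x : affineWeyl P) (a : ι × ℤ) :
    ∃ a', ∀ v, affRoot P a ((x : N ≃ᵃ[ℝ] N) v) = affRoot P a' v := by
  obtain ⟨x, hx⟩ := x
  change ∃ a', ∀ v, affRoot P a (x v) = affRoot P a' v
  induction hx using Subgroup.closure_induction'' generalizing a with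
  | one => exact ⟨a, fun v ↦ rfl⟩
  | mem y hy => obtain ⟨i, k, rfl⟩ := hy; exact exists_affRoot_affReflection a (i, k)
  | inv_mem y hy =>
    obtain ⟨i, k, rfl⟩ := hy
    have h : (affineRefl P i k)⁻¹ = affineRefl P i k :=
      congrArg Subtype.val (affReflection_inv (P := P) (i, k))
    rw [h]
    exact exists_affRoot_affReflection a (i, k)
  | mul y z _ _ h h' =>
    obtain ⟨a', ha⟩ := h a
    obtain ⟨a'', ha'⟩ := h' a'
    exact ⟨a'', fun v ↦ (ha _).trans (ha' v)⟩

/-- Subtracting the values at `0` leaves the gradients. This turns the wall `a ∘ x` into a condition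
on `π x` alone. -/
lemma root'_proj_of_affRoot {x : affineWeyl P} {a a' : ι × ℤ}
    (h : ∀ v, affRoot P a ((x : N ≃ᵃ[ℝ] N) v) = affRoot P a' v) (v : N) :
    P.root' a.1 ((proj P x : N ≃ₗ[ℝ] N) v) = P.root' a'.1 v := by
  have hx : (x : N ≃ᵃ[ℝ] N) v = (proj P x : N ≃ₗ[ℝ] N) v + (x : N ≃ᵃ[ℝ] N) 0 := by
    change _ = (x : N ≃ᵃ[ℝ] N).linear v + _
    simpa using (x : N ≃ᵃ[ℝ] N).map_vadd 0 v
  have h1 := h v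
  have h0 := h 0
  rw [hx] at h1
  simp only [affRoot, map_add, map_zero] at h1 h0
  linarith

lemma exists_root'_apply (w : weyl P) (i : ι) :
    ∃ j, ∀ v, P.root' i ((w : N ≃ₗ[ℝ] N) v) = P.root' j v := by
  obtain ⟨w, hw⟩ := w
  change ∃ j, ∀ v, P.root' i (w v) = P.root' j v
  induction hw using Subgroup.closure_induction'' generalizing i with
  | one => exact ⟨i, fun v ↦ rfl⟩
  | mem y hy => obtain ⟨j, rfl⟩ := hy; exact ⟨_, root'_coreflection i j⟩
  | inv_mem y hy =>
    obtain ⟨j, rfl⟩ := hy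
    rw [P.coreflection_inv]
    exact ⟨_, root'_coreflection i j⟩
  | mul y z _ _ h h' =>
    obtain ⟨a', ha⟩ := h i
    obtain ⟨a'', ha'⟩ := h' a'
    exact ⟨a'', fun v ↦ (ha _).trans (ha' v)⟩

variable [Finite ι] [P.IsCrystallographic]

/-- All roots lie in `(-1, 1)` on `A°`, so a nonzero integer constant decides the sign. In
particular the sign is the same at all points of `A°`. -/
lemma affRoot_pos_iff (hθ : IsHighestRoot b θ) (hv : v ∈ fundAlcove b θ) (a : ι × ℤ) :
    0 < affRoot P a v ↔ 0 < a.2 ∨ (a.2 = 0 ∧ b.IsPos a.1) := by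
  rw [isPos_iff_root'_pos hv.1, affRoot]
  have h := abs_lt.1 (hθ.abs_root'_lt_one hv a.1)
  rcases lt_trichotomy a.2 0 with hk | hk | hk
  · have : (a.2 : ℝ) ≤ -1 := by exact_mod_cast Int.le_sub_one_of_lt hk
    constructor
    · intro; linarith
    · rintro (h | h) <;> omega
  · simp [hk]
  · have : (1 : ℝ) ≤ a.2 := by exact_mod_cast hk
    simp only [hk, true_or, iff_true]
    linarith

lemma affRoot_ne_zero (hθ : IsHighestRoot b θ) (hv : v ∈ fundAlcove b θ) (a : ι × ℤ) :
    affRoot P a v ≠ 0 := by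
  intro h0
  have h := abs_lt.1 (hθ.abs_root'_lt_one hv a.1)
  have h1 := root'_ne_zero hv.1 a.1
  rw [affRoot] at h0
  have h2 : P.root' a.1 v = ((-a.2 : ℤ) : ℝ) := by push_cast; linarith
  rw [h2] at h h1
  norm_cast at h h1
  omega

lemma affRoot_pos_congr (hθ : IsHighestRoot b θ) {u : N} (hu : u ∈ fundAlcove b θ)
    (hv : v ∈ fundAlcove b θ) (a : ι × ℤ) : 0 < affRoot P a u ↔ 0 < affRoot P a v := by
  rw [affRoot_pos_iff hθ hu, affRoot_pos_iff hθ hv]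

/-- A simple affine reflection preserves the positive affine roots other than its own. -/
lemma affRoot_affReflection_pos [P.IsReduced] (hθ : IsHighestRoot b θ) (hv : v ∈ fundAlcove b θ)
    {a c : ι × ℤ} (ha : IsSimpleAff b θ a) (hc : 0 < affRoot P c v) (hca : c ≠ a) :
    0 < affRoot P c ((affReflection P a : N ≃ᵃ[ℝ] N) v) := by
  obtain ⟨i, k⟩ := c
  have hi1 := abs_lt.1 (hθ.abs_root'_lt_one hv i)
  have hneg : ∀ j, P.reflectionPerm i i ≠ j → i ≠ P.reflectionPerm j j := by
    rintro j hj rfl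
    exact hj (reflectionPerm_self_self j)
  have hk := (affRoot_pos_iff hθ hv (i, k)).1 hc
  rw [isPos_iff_root'_pos hv.1] at hk
  dsimp only at hk
  rcases ha with ⟨hj, h0⟩ | rfl
  · obtain ⟨j, m⟩ := a
    dsimp only at hj h0
    subst h0
    have hval : affRoot P (i, k) ((affReflection P (j, 0) : N ≃ᵃ[ℝ] N) v) =
        P.root' (P.reflectionPerm j i) v + k := by
      rw [affRoot, root'_affReflection, root'_reflectionPerm, affRoot]; push_cast; ring
    rw [hval]
    have h1 := abs_lt.1 (hθ.abs_root'_lt_one hv (P.reflectionPerm j i))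
    rcases hk with hk | ⟨rfl, hk⟩
    · have : (1 : ℝ) ≤ k := by exact_mod_cast hk
      linarith
    · simpa using root'_reflectionPerm_pos hv.1 hk hj (fun h ↦ hca (by rw [h]))
  · have hval : affRoot P (i, k)
        ((affReflection P (P.reflectionPerm θ θ, 1) : N ≃ᵃ[ℝ] N) v) =
        P.root' i v + k + (1 - P.root' θ v) * P.pairing i θ := by
      rw [affRoot, root'_affReflection, affRoot, root'_reflectionPerm_self]
      simp
      ring
    rw [hval]
    have hθ1 : P.root' θ v < 1 := hv.2
    have hθ0 := hθ.root'_pos hv.1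
    have hk0 : (0 : ℝ) ≤ k := by exact_mod_cast (by omega : 0 ≤ k)
    -- Only a negative pairing with `θ^∨` can lower the value. This forces `α_i` negative, hence `k
    -- ≥ 1`, which absorbs the loss.
    rcases lt_or_gt_of_ne (root'_ne_zero hv.1 i) with hi | hi
    · have hk1 : 1 ≤ k := by
        rcases hk with hk | hk
        · omega
        · linarith
      have hk1' : (1 : ℝ) ≤ k := by exact_mod_cast hk1
      rcases eq_or_ne (P.reflectionPerm i i) θ with h | h
      · have hi' : i = P.reflectionPerm θ θ := by rw [← h, reflectionPerm_self_self]
        -- For `k = 1` this would be the simple affine root `1 - θ` itself. With `k ≥ 2` the new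
        -- value is `k - 2 + θ(v) > 0`.
        have hk2 : 2 ≤ k := by
          by_contra! hlt
          exact hca (by rw [hi', show k = 1 by omega])
        have hk2' : (2 : ℝ) ≤ k := by exact_mod_cast hk2
        rw [hi', root'_reflectionPerm_self, RootPairing.pairing_reflectionPerm_self_left,
          RootPairing.pairing_same]
        linarith
      · have hp := hθ.pairing_eq_zero_or_one hv.1 (i := P.reflectionPerm i i)
          (by rw [root'_reflectionPerm_self]; linarith) h
        rw [RootPairing.pairing_reflectionPerm_self_left] at hp
        have hlt := hθ.root'_lt hv.1 h
        rw [root'_reflectionPerm_self] at hlt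
        rcases hp with hp | hp
        · rw [neg_eq_zero.1 hp]; linarith
        · rw [neg_eq_iff_eq_neg.1 hp]; linarith
    · rcases eq_or_ne i θ with rfl | h
      · rw [RootPairing.pairing_same]; linarith
      · rcases hθ.pairing_eq_zero_or_one hv.1 hi h with hp | hp <;> rw [hp] <;> linarith

end AffineRoots

end AffWalk

namespace AffWalk

/-! ### Length, descents and Bruhat order on `W` -/

section Length

variable {ι M N : Type*} [AddCommGroup M] [Module ℝ M] [AddCommGroup N] [Module ℝ N]
  {P : RootPairing ι ℝ M N} {b : P.Base} {θ : ι} {v : N}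

lemma refl_reflectionPerm (i j : ι) :
    refl P (P.reflectionPerm i j) = refl P i * refl P j * refl P i := by
  ext v
  change P.coreflection (P.reflectionPerm i j) v =
    P.coreflection i (P.coreflection j (P.coreflection i v))
  have h : P.coroot (P.reflectionPerm i j) = P.coreflection i (P.coroot j) := by simp
  rw [RootPairing.coreflection_apply, P.coreflection_apply j, map_sub, map_smul,
    RootPairing.coreflection_same, root'_coreflection, h]

lemma refl_reflectionPerm_self (i : ι) : refl P (P.reflectionPerm i i) = refl P i :=
  Subtype.ext (coreflection_reflectionPerm_self i)

/-- In `length` the whole list is coerced to a `List ι` through the list monad; here each index is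
coerced separately. -/
lemma length_eq_sInf (b : P.Base) (w : weyl P) : length b w =
    sInf {n | ∃ l : List b.support, l.length = n ∧
      (l.map fun i : b.support ↦ refl P i).prod = w} := by
  have h : ∀ l : List b.support, (do let a ← l; pure (a : ι)) =
      l.map fun a : b.support ↦ (a : ι) := fun l ↦
    List.map_eq_flatMap.symm
  simp only [length, h, List.map_map]
  rfl

lemma length_le_of_prod (b : P.Base) (l : List b.support) :
    length b (l.map fun i : b.support ↦ refl P i).prod ≤ l.length := by
  rw [length_eq_sInf]
  exact Nat.sInf_le ⟨l, rfl, rfl⟩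

/-- The exchange condition. If the first letter `s_a` is the reflection in `α_i`, delete it.
Otherwise `s_a α_i` is still positive, and since `r_i s_a = s_a r_{s_a α_i}`, the letter to delete
is found in the tail by induction. -/
lemma length_refl_mul_lt_of_word [Finite ι] [P.IsCrystallographic] [P.IsReduced]
    (hv : v ∈ fundChamber b) (l : List b.support) {i : ι} (hi : 0 < P.root' i v)
    (hw : P.root' i (((l.map fun i : b.support ↦ refl P i).prod : N ≃ₗ[ℝ] N) v) < 0) :
    ∃ l' : List b.support, l'.length < l.length ∧
      (l'.map fun i : b.support ↦ refl P i).prod =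
        refl P i * (l.map fun i : b.support ↦ refl P i).prod := by
  induction l generalizing i with
  | nil => exact absurd hw hi.not_gt
  | cons a t ih =>
    rw [List.map_cons, List.prod_cons] at hw ⊢
    rcases eq_or_ne i a with rfl | hia
    · exact ⟨t, by simp, by rw [← mul_assoc, refl_mul_self, one_mul]⟩
    · have hpos := root'_reflectionPerm_pos hv hi a.2 hia
      change P.root' i (P.coreflection a
        (((t.map fun i : b.support ↦ refl P i).prod : N ≃ₗ[ℝ] N) v)) < 0 at hw
      rw [root'_coreflection] at hw
      obtain ⟨t', ht', hprod⟩ := ih hpos hw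
      refine ⟨a :: t', by simpa using ht', ?_⟩
      rw [List.map_cons, List.prod_cons, hprod, refl_reflectionPerm]
      simp only [← mul_assoc, refl_mul_self, one_mul]

variable [Finite ι] [P.IsCrystallographic] [P.IsReduced]

lemma refl_mem_closure (b : P.Base) (i : ι) :
    refl P i ∈ Subgroup.closure ((fun j ↦ refl P j) '' (b.support : Set ι)) := by
  refine b.induction_reflect i (p := fun i ↦ refl P i ∈ Subgroup.closure _) ?_ ?_ ?_
  · intro i hi
    rwa [refl_reflectionPerm_self]
  · exact fun i hi ↦ Subgroup.subset_closure ⟨i, hi, rfl⟩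
  · intro i j hi hj
    have h := Subgroup.subset_closure (G := weyl P)
      (Set.mem_image_of_mem (fun j ↦ refl P j) (Finset.mem_coe.2 hj))
    rw [refl_reflectionPerm]
    exact mul_mem (mul_mem h hi) h

lemma exists_word (b : P.Base) (w : weyl P) :
    ∃ l : List b.support, (l.map fun i : b.support ↦ refl P i).prod = w := by
  have hcl : w ∈ Subgroup.closure ((fun j ↦ refl P j) '' (b.support : Set ι)) := by
    have h : weyl P ≤ (Subgroup.closure
        ((fun j ↦ refl P j) '' (b.support : Set ι))).map (weyl P).subtype := by
      refine (Subgroup.closure_le _).2 ?_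
      rintro _ ⟨i, rfl⟩
      exact ⟨refl P i, refl_mem_closure b i, rfl⟩
    obtain ⟨w', hw', h'⟩ := h w.2
    rwa [← Subtype.ext h']
  induction hcl using Subgroup.closure_induction'' with
  | one => exact ⟨[], rfl⟩
  | mem y hy => obtain ⟨j, hj, rfl⟩ := hy; exact ⟨[⟨j, hj⟩], by simp⟩
  | inv_mem y hy =>
    obtain ⟨j, hj, rfl⟩ := hy
    exact ⟨[⟨j, hj⟩], by simp [eq_inv_iff_mul_eq_one, refl_mul_self]⟩
  | mul y z _ _ hy hz =>
    obtain ⟨l, hl⟩ := hy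
    obtain ⟨l', hl'⟩ := hz
    exact ⟨l ++ l', by rw [List.map_append, List.prod_append, hl, hl']⟩

lemma exists_reduced_word (b : P.Base) (w : weyl P) :
    ∃ l : List b.support, l.length = length b w ∧
      (l.map fun i : b.support ↦ refl P i).prod = w := by
  obtain ⟨l, hl⟩ := exists_word b w
  rw [length_eq_sInf]
  exact Nat.sInf_mem (s := {n | ∃ l : List b.support, l.length = n ∧
    (l.map fun i : b.support ↦ refl P i).prod = w}) ⟨_, l, rfl, hl⟩

lemma length_refl_mul_lt (hv : v ∈ fundChamber b) {w : weyl P} {i : ι} (hi : 0 < P.root' i v)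
    (hw : P.root' i ((w : N ≃ₗ[ℝ] N) v) < 0) : length b (refl P i * w) < length b w := by
  obtain ⟨l, hl, rfl⟩ := exists_reduced_word b w
  obtain ⟨l', hl', hprod⟩ := length_refl_mul_lt_of_word hv l hi hw
  rw [← hl, ← hprod]
  exact (length_le_of_prod b l').trans_lt hl'

omit [P.IsReduced] in
lemma root'_apply_ne_zero (hv : v ∈ fundChamber b) (w : weyl P) (i : ι) :
    P.root' i ((w : N ≃ₗ[ℝ] N) v) ≠ 0 := by
  obtain ⟨j, hj⟩ := exists_root'_apply w i
  rw [hj]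
  exact root'_ne_zero hv j

lemma length_refl_mul_lt_iff (hv : v ∈ fundChamber b) {w : weyl P} {i : ι}
    (hi : 0 < P.root' i v) :
    length b (refl P i * w) < length b w ↔ P.root' i ((w : N ≃ₗ[ℝ] N) v) < 0 := by
  refine ⟨fun h ↦ ?_, length_refl_mul_lt hv hi⟩
  by_contra! hw
  replace hw := lt_of_le_of_ne hw (root'_apply_ne_zero hv w i).symm
  -- Otherwise the exchange condition applies to `r_i w` and gives the opposite inequality of
  -- lengths.
  have h' : P.root' i (((refl P i * w : weyl P) : N ≃ₗ[ℝ] N) v) < 0 := by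
    change P.root' i (P.coreflection i ((w : N ≃ₗ[ℝ] N) v)) < 0
    rw [root'_coreflection, root'_reflectionPerm_self]
    linarith
  have := length_refl_mul_lt hv hi h'
  rw [← mul_assoc, refl_mul_self, one_mul] at this
  omega

omit [Finite ι] [P.IsCrystallographic] [P.IsReduced] in
lemma BruhatLT.length_lt {u w : weyl P} (h : BruhatLT b u w) : length b u < length b w := by
  induction h with
  | single h => obtain ⟨i, -, h⟩ := h; exact h
  | tail _ h ih => obtain ⟨i, -, h⟩ := h; exact ih.trans h

omit [Finite ι] [P.IsCrystallographic] [P.IsReduced] in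
-- Every Bruhat chain raises the length, and between `w` and `r_i w` a single link suffices.
lemma bruhatLT_refl_mul_iff (w : weyl P) (i : ι) :
    BruhatLT b w (refl P i * w) ↔ length b w < length b (refl P i * w) :=
  ⟨BruhatLT.length_lt, fun h ↦ .single ⟨i, rfl, h⟩⟩

omit [Finite ι] [P.IsCrystallographic] [P.IsReduced] in
lemma refl_mul_bruhatLT_iff (w : weyl P) (i : ι) :
    BruhatLT b (refl P i * w) w ↔ length b (refl P i * w) < length b w :=
  ⟨BruhatLT.length_lt, fun h ↦ .single ⟨i, by rw [← mul_assoc, refl_mul_self, one_mul], h⟩⟩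

/-- The steps of the chain on `W`, uniformly in terms of the simple affine roots. -/
lemma weylStep_iff (hθ : IsHighestRoot b θ) (hv : v ∈ fundChamber b) {w u : weyl P} :
    WeylStep b θ w u ↔ ∃ a, IsSimpleAff b θ a ∧ u = refl P a.1 * w ∧
      P.root' a.1 ((w : N ≃ₗ[ℝ] N) v) < 0 := by
  have h1 : ∀ i ∈ b.support,
      (BruhatLT b (refl P i * w) w ↔ P.root' i ((w : N ≃ₗ[ℝ] N) v) < 0) := fun i hi ↦ by
    rw [refl_mul_bruhatLT_iff, length_refl_mul_lt_iff hv (hv i hi)]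
  have h2 : BruhatLT b w (refl P θ * w) ↔
      P.root' (P.reflectionPerm θ θ) ((w : N ≃ₗ[ℝ] N) v) < 0 := by
    -- An ascent from `w` is a descent from `r_θ w`, and `θ` at `r_θ w v` equals `-θ` at `w v`.
    have h := length_refl_mul_lt_iff hv (w := refl P θ * w) (hθ.root'_pos hv)
    rw [← mul_assoc, refl_mul_self, one_mul] at h
    rw [bruhatLT_refl_mul_iff, h, ← root'_coreflection]
    rfl
  constructor
  · rintro (⟨i, hi, rfl, h⟩ | ⟨rfl, h⟩)
    · exact ⟨(i, 0), .inl ⟨hi, rfl⟩, rfl, (h1 i hi).1 h⟩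
    · exact ⟨_, .inr rfl, by rw [refl_reflectionPerm_self], h2.1 h⟩
  · rintro ⟨⟨i, k⟩, ⟨hi, hk⟩ | h, rfl, hlt⟩
    · exact .inl ⟨i, hi, rfl, (h1 i hi).2 hlt⟩
    · obtain ⟨rfl, rfl⟩ := Prod.mk.inj h
      rw [refl_reflectionPerm_self]
      exact .inr ⟨rfl, h2.2 hlt⟩

/-- The first letter of a nonempty reduced word of `w` would be a descent, so the corresponding
simple root would be negative at `w v`. -/
lemma eq_one_of_forall_root'_pos (hv : v ∈ fundChamber b) {w : weyl P}
    (h : ∀ i ∈ b.support, 0 < P.root' i ((w : N ≃ₗ[ℝ] N) v)) : w = 1 := by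
  obtain ⟨l, hl, hw⟩ := exists_reduced_word b w
  rcases l with _ | ⟨a, t⟩
  · simpa using hw.symm
  · exfalso
    have h1 := h a a.2
    have h2 : length b (refl P a * w) < length b w := by
      rw [← hl, ← hw, List.map_cons, List.prod_cons, ← mul_assoc, refl_mul_self, one_mul]
      exact (length_le_of_prod b t).trans_lt (by simp)
    rw [length_refl_mul_lt_iff hv (hv a a.2)] at h2
    linarith

end Length

/-! ### Free action of the affine Weyl group on alcoves -/

section Free

variable {ι M N : Type*} [AddCommGroup M] [Module ℝ M] [AddCommGroup N] [Module ℝ N]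
  {P : RootPairing ι ℝ M N} {b : P.Base} {θ : ι} {v : N}

lemma exists_list_of_mem_corootLattice {x : N} (hx : x ∈ corootLattice P) :
    ∃ l : List ι, (l.map P.coroot).sum = x := by
  induction hx using AddSubgroup.closure_induction with
  | mem y hy => obtain ⟨i, rfl⟩ := hy; exact ⟨[i], by simp⟩
  | zero => exact ⟨[], rfl⟩
  | add y z _ _ hy hz =>
    obtain ⟨l, rfl⟩ := hy
    obtain ⟨l', rfl⟩ := hz
    exact ⟨l ++ l', by simp⟩
  | neg y _ hy =>
    obtain ⟨l, rfl⟩ := hy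
    refine ⟨l.map fun i ↦ P.reflectionPerm i i, ?_⟩
    clear * -
    induction l with
    | nil => simp
    | cons a t ih => simp only [List.map_cons, List.sum_cons, ih]; simp [add_comm]

variable [Finite ι] [P.IsCrystallographic]

/-- The coroot lattice contains no nonzero vector on which all roots take values in `(-2, 2)`. -/
lemma eq_zero_of_mem_corootLattice {x : N} (hx : x ∈ corootLattice P)
    (h : ∀ i, P.root' i x < 2) : x = 0 := by
  classical
  have hex : ∃ n, ∃ l : List ι, l.length = n ∧ (l.map P.coroot).sum = x := by
    obtain ⟨l, hl⟩ := exists_list_of_mem_corootLattice hx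
    exact ⟨_, l, rfl, hl⟩
  obtain ⟨l, hl, rfl⟩ := Nat.find_spec hex
  -- Take a shortest expression of `x` as a sum of coroots.
  have hmin : ∀ l' : List ι, (l'.map P.coroot).sum = (l.map P.coroot).sum →
      l.length ≤ l'.length := fun l' h' ↦ by
    rw [hl]; exact Nat.find_min' hex ⟨l', rfl, h'⟩
  clear hl
  rcases l with _ | ⟨a, t⟩
  · simp
  exfalso
  -- If `⟨α_a, c^∨⟩ < 0`, then `a^∨ + c^∨` is zero or a coroot, and the expression can be shortened.
  -- So all pairings with `α_a` are non-negative, and `a^∨` itself contributes `2` to `α_a(x)`.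
  have hp : ∀ c ∈ t, 0 ≤ P.pairing a c := by
    intro c hc
    by_contra! hneg
    obtain ⟨s, hs⟩ : ∃ s, t.Perm (c :: s) := ⟨_, List.perm_cons_erase hc⟩
    have hsum : ((a :: t).map P.coroot).sum =
        P.coroot a + P.coroot c + (s.map P.coroot).sum := by
      rw [List.map_cons, List.sum_cons, (hs.map P.coroot).sum_eq, List.map_cons, List.sum_cons,
        add_assoc]
    have hlen : t.length = s.length + 1 := by rw [hs.length_eq, List.length_cons]
    rw [hsum] at hmin
    by_cases hac : P.coroot a = -P.coroot c
    · have := hmin s (by rw [hac]; simp)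
      simp [hlen] at this
    · have hneg' : P.flip.pairingIn ℤ c a < 0 := by
        have h1 : ((P.flip.pairingIn ℤ c a : ℤ) : ℝ) = P.pairing a c :=
          P.flip.algebraMap_pairingIn ℤ c a
        rw [← h1] at hneg
        exact_mod_cast hneg
      obtain ⟨d, hd⟩ := P.flip.root_add_root_mem_of_pairingIn_neg hneg'
        (fun h' ↦ hac (neg_eq_iff_eq_neg.1 h'.symm).symm.symm)
      have hd' : P.coroot d = P.coroot c + P.coroot a := hd
      have := hmin (d :: s) (by rw [List.map_cons, List.sum_cons, hd', add_comm (P.coroot c)])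
      simp [hlen] at this
  have hsum : ∀ s : List ι, (∀ c ∈ s, 0 ≤ P.pairing a c) →
      0 ≤ P.root' a (s.map P.coroot).sum := by
    intro s
    induction s with
    | nil => simp
    | cons c s ih =>
      intro hs
      rw [List.map_cons, List.sum_cons, map_add]
      exact add_nonneg (hs c (by simp)) (ih fun d hd ↦ hs d (by simp [hd]))
  have h1 := h a
  have h2 := hsum t hp
  rw [List.map_cons, List.sum_cons, map_add, RootPairing.root'_coroot_eq_pairing,
    RootPairing.pairing_same] at h1
  linarith

/-- The affine Weyl group acts freely on alcoves. -/
lemma eq_one_of_apply_mem_fundAlcove [P.IsReduced] (hθ : IsHighestRoot b θ)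
    (hv : v ∈ fundAlcove b θ) {g : affineWeyl P} (hg : (g : N ≃ᵃ[ℝ] N) v ∈ fundAlcove b θ) :
    g = 1 := by
  have hlin : ∀ u, (g : N ≃ᵃ[ℝ] N) u = (proj P g : N ≃ₗ[ℝ] N) u + (g : N ≃ᵃ[ℝ] N) 0 := fun u ↦ by
    change _ = (g : N ≃ᵃ[ℝ] N).linear u + _
    simpa using (g : N ≃ᵃ[ℝ] N).map_vadd 0 u
  -- The translation part is `g v - (π g) v`. Roots lie in `(-1, 1)` at `g v` and at `v`, and `π g`
  -- permutes them, so each root is below `2` on the difference.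
  have h0 : (g : N ≃ᵃ[ℝ] N) 0 = 0 := by
    refine eq_zero_of_mem_corootLattice (apply_mem_corootLattice P g 0 (zero_mem _)) fun i ↦ ?_
    obtain ⟨j, hj⟩ := exists_root'_apply (proj P g) i
    have h1 := abs_lt.1 (hθ.abs_root'_lt_one hg i)
    have h2 := abs_lt.1 (hθ.abs_root'_lt_one hv j)
    rw [hlin v, map_add, hj] at h1
    linarith
  have hw : proj P g = 1 := eq_one_of_forall_root'_pos (b := b) hv.1 fun i hi ↦ by
    have := hg.1 i hi
    rwa [hlin v, h0, add_zero] at this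
  ext u
  rw [hlin u, h0, hw, add_zero]
  rfl

end Free

end AffWalk

namespace AffWalk

/-! ### Adjacency of alcoves and the steps inside the fundamental chamber -/

section Steps

variable {ι M N : Type*} [AddCommGroup M] [Module ℝ M] [AddCommGroup N] [Module ℝ N]
  {P : RootPairing ι ℝ M N} {b : P.Base} {θ : ι} {v : N}

lemma apply_inv_apply (x : affineWeyl P) (v : N) :
    (x : N ≃ᵃ[ℝ] N) (((x⁻¹ : affineWeyl P) : N ≃ᵃ[ℝ] N) v) = v :=
  (x : N ≃ᵃ[ℝ] N).apply_symm_apply v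

lemma inv_apply_apply (x : affineWeyl P) (v : N) :
    ((x⁻¹ : affineWeyl P) : N ≃ᵃ[ℝ] N) ((x : N ≃ᵃ[ℝ] N) v) = v :=
  (x : N ≃ᵃ[ℝ] N).symm_apply_apply v

lemma affReflection_apply_apply (a : ι × ℤ) (v : N) :
    (affReflection P a : N ≃ᵃ[ℝ] N) ((affReflection P a : N ≃ᵃ[ℝ] N) v) = v := by
  have := inv_apply_apply (affReflection P a) v
  rwa [affReflection_inv] at this

lemma hyperplane_eq (a : ι × ℤ) : hyperplane P a.1 a.2 = {v | affRoot P a v = 0} := by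
  ext v
  exact eq_neg_iff_add_eq_zero

lemma mem_separating {A B H : Set N} : H ∈ separating P A B ↔ ∃ a : ι × ℤ,
    H = {v | affRoot P a v = 0} ∧ (∀ v ∈ A, 0 < affRoot P a v) ∧ ∀ v ∈ B, affRoot P a v < 0 := by
  constructor
  · rintro ⟨i, k, rfl, h⟩
    exact ⟨(i, k), hyperplane_eq (i, k), h⟩
  · rintro ⟨a, rfl, h⟩
    exact ⟨a.1, a.2, (hyperplane_eq a).symm, h⟩

lemma mem_alcove {x : affineWeyl P} : v ∈ alcove b θ x ↔ (x : N ≃ᵃ[ℝ] N) v ∈ fundAlcove b θ :=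
  Iff.rfl

lemma inv_apply_mem_alcove (hv : v ∈ fundAlcove b θ) (x : affineWeyl P) :
    ((x⁻¹ : affineWeyl P) : N ≃ᵃ[ℝ] N) v ∈ alcove b θ x := by
  rwa [mem_alcove, apply_inv_apply]

lemma inv_apply_affReflection_mem_alcove (hv : v ∈ fundAlcove b θ) (x : affineWeyl P)
    (a : ι × ℤ) :
    ((x⁻¹ : affineWeyl P) : N ≃ᵃ[ℝ] N) ((affReflection P a : N ≃ᵃ[ℝ] N) v) ∈
      alcove b θ (affReflection P a * x) := by
  rw [mem_alcove]
  change (affReflection P a : N ≃ᵃ[ℝ] N) ((x : N ≃ᵃ[ℝ] N) _) ∈ _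
  rwa [apply_inv_apply, affReflection_apply_apply]

variable [P.IsCrystallographic]

lemma exists_affRoot_eq_apply (x : affineWeyl P) (a : ι × ℤ) :
    ∃ a', ∀ v, affRoot P a v = affRoot P a' ((x : N ≃ᵃ[ℝ] N) v) := by
  obtain ⟨a', ha⟩ := exists_affRoot_apply x⁻¹ a
  exact ⟨a', fun v ↦ by rw [← ha, inv_apply_apply]⟩

variable [Finite ι]

lemma affRoot_pos_congr_alcove (hθ : IsHighestRoot b θ) {x : affineWeyl P} {u : N}
    (hu : u ∈ alcove b θ x) (hv : v ∈ alcove b θ x) (a : ι × ℤ) :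
    0 < affRoot P a u ↔ 0 < affRoot P a v := by
  obtain ⟨a', ha⟩ := exists_affRoot_eq_apply x a
  rw [ha, ha]
  exact affRoot_pos_congr hθ hu hv a'

lemma affRoot_ne_zero_alcove (hθ : IsHighestRoot b θ) {x : affineWeyl P}
    (hv : v ∈ alcove b θ x) (a : ι × ℤ) : affRoot P a v ≠ 0 := by
  obtain ⟨a', ha⟩ := exists_affRoot_eq_apply x a
  rw [ha]
  exact affRoot_ne_zero hθ hv a'

lemma affRoot_neg_of_alcove (hθ : IsHighestRoot b θ) {x : affineWeyl P} {u : N}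
    (hu : u ∈ alcove b θ x) (hv : v ∈ alcove b θ x) {a : ι × ℤ} (h : affRoot P a u ≤ 0) :
    affRoot P a v < 0 := by
  refine lt_of_le_of_ne (not_lt.1 fun h' ↦ ?_) (affRoot_ne_zero_alcove hθ hv a)
  exact h.not_gt ((affRoot_pos_congr_alcove hθ hu hv a).2 h')

variable [P.IsReduced]

/-- Alcoves related by a simple affine reflection (on the left) are adjacent. -/
lemma separating_affReflection_mul (hθ : IsHighestRoot b θ) (hv : v ∈ fundAlcove b θ)
    (x : affineWeyl P) {a : ι × ℤ} (ha : IsSimpleAff b θ a) :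
    separating P (alcove b θ x) (alcove b θ (affReflection P a * x)) =
      {{u | affRoot P a ((x : N ≃ᵃ[ℝ] N) u) = 0}} := by
  ext H
  rw [mem_separating, Set.mem_singleton_iff]
  constructor
  · rintro ⟨c, rfl, hpos, hneg⟩
    obtain ⟨c', hc⟩ := exists_affRoot_eq_apply x c
    have h1 := hpos _ (inv_apply_mem_alcove hv x)
    have h2 := hneg _ (inv_apply_affReflection_mem_alcove hv x a)
    rw [hc, apply_inv_apply] at h1 h2
    -- The only affine root positive at `v` and negative at its mirror image under the reflection in
    -- `a` is `a` itself.
    have h3 : c' = a := by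
      by_contra hne
      exact h2.not_gt (affRoot_affReflection_pos hθ hv ha h1 hne)
    ext u
    rw [Set.mem_ofPred_eq, Set.mem_ofPred_eq, hc, h3]
  · rintro rfl
    obtain ⟨a', ha'⟩ := exists_affRoot_apply x a
    refine ⟨a', by ext u; rw [Set.mem_ofPred_eq, Set.mem_ofPred_eq, ha'],
      fun u hu ↦ ?_, fun u hu ↦ ?_⟩
    · rw [← ha']
      exact mem_fundAlcove_iff.1 hu a ha
    · have := mem_fundAlcove_iff.1 hu a ha
      change 0 < affRoot P a ((affReflection P a : N ≃ᵃ[ℝ] N) ((x : N ≃ᵃ[ℝ] N) u)) at this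
      rw [affRoot_affReflection_self] at this
      rw [← ha']
      linarith

/-- Adjacent alcoves are related by a simple affine reflection (on the left). -/
lemma exists_eq_affReflection_mul (hθ : IsHighestRoot b θ) (hv : v ∈ fundAlcove b θ)
    {x y : affineWeyl P} {H : Set N} (hH : separating P (alcove b θ x) (alcove b θ y) = {H}) :
    ∃ a, IsSimpleAff b θ a ∧ y = affReflection P a * x := by
  set g : affineWeyl P := x * y⁻¹ with hg
  have hgv : (g : N ≃ᵃ[ℝ] N) v = (x : N ≃ᵃ[ℝ] N) (((y⁻¹ : affineWeyl P) : N ≃ᵃ[ℝ] N) v) := rfl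
  -- Applying `x` moves `A_x` to `A°` and `A_y` to `g A°`. Every affine root changing sign between
  -- these gives a separating hyperplane, so all of them give `H`.
  have hsep : ∀ c, 0 < affRoot P c v → affRoot P c ((g : N ≃ᵃ[ℝ] N) v) ≤ 0 →
      {u | affRoot P c ((x : N ≃ᵃ[ℝ] N) u) = 0} = H := by
    intro c h1 h2
    rw [← Set.mem_singleton_iff, ← hH, mem_separating]
    obtain ⟨c', hc⟩ := exists_affRoot_apply x c
    refine ⟨c', by ext u; rw [Set.mem_ofPred_eq, Set.mem_ofPred_eq, hc],
      fun u hu ↦ ?_, fun u hu ↦ ?_⟩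
    · rw [← affRoot_pos_congr_alcove hθ (inv_apply_mem_alcove hv x) hu, ← hc, apply_inv_apply]
      exact h1
    · refine affRoot_neg_of_alcove hθ (inv_apply_mem_alcove hv y) hu ?_
      rw [← hc, ← hgv]
      exact h2
  obtain ⟨a, ha, hag⟩ : ∃ a, IsSimpleAff b θ a ∧ affRoot P a ((g : N ≃ᵃ[ℝ] N) v) ≤ 0 := by
    by_contra! hcon
    have hmem := mem_fundAlcove_iff.2 hcon
    have hxy : x = y := by
      rw [← mul_inv_eq_one, ← hg]
      exact eq_one_of_apply_mem_fundAlcove hθ hv hmem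
    have hH' : H ∈ separating P (alcove b θ x) (alcove b θ y) := hH ▸ rfl
    obtain ⟨c, -, h1, h2⟩ := mem_separating.1 hH'
    rw [hxy] at h1
    exact (h1 _ (inv_apply_mem_alcove hv y)).not_gt (h2 _ (inv_apply_mem_alcove hv y))
  have hav := mem_fundAlcove_iff.1 hv a ha
  refine ⟨a, ha, ?_⟩
  have hsg : affReflection P a * g = 1 := by
    refine eq_one_of_apply_mem_fundAlcove hθ hv (mem_fundAlcove_iff.2 fun c hc ↦ ?_)
    change 0 < affRoot P c ((affReflection P a : N ≃ᵃ[ℝ] N) ((g : N ≃ᵃ[ℝ] N) v))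
    by_contra! hneg
    have hcv := mem_fundAlcove_iff.1 hv c hc
    rcases eq_or_ne c a with rfl | hca
    · rw [affRoot_affReflection_self] at hneg
      have hgmem : ((y⁻¹ : affineWeyl P) : N ≃ᵃ[ℝ] N) v ∈ alcove b θ y := inv_apply_mem_alcove hv y
      obtain ⟨c', hc'⟩ := exists_affRoot_apply x c
      have := affRoot_ne_zero_alcove hθ hgmem c'
      rw [← hc', ← hgv] at this
      exact this (by linarith)
    · have hpos := affRoot_affReflection_pos hθ hv ha hcv hca
      obtain ⟨c', hc'⟩ := exists_affRoot_apply (affReflection P a) c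
      -- Both `a` and `c' = c ∘ s_a` change sign between `v` and `g v`, so they have the same zero
      -- set. But the midpoint `p` of `v` and `s_a v` lies on the wall of `a`, while `c'` is
      -- positive at both ends.
      have h1 := hsep a hav hag
      have h2 := hsep c' (by rwa [← hc']) (by rwa [← hc'])
      set p : N := (1 - (1 / 2 : ℝ)) • v + (1 / 2 : ℝ) • (affReflection P a : N ≃ᵃ[ℝ] N) v with hp
      have hp1 : affRoot P a p = 0 := by
        rw [hp, affRoot_combo, affRoot_affReflection_self]; ring
      have hp2 : 0 < affRoot P c' p := by
        rw [hp, affRoot_combo, ← hc', ← hc', affReflection_apply_apply]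
        linarith
      have hmem : ((x⁻¹ : affineWeyl P) : N ≃ᵃ[ℝ] N) p ∈
          {u | affRoot P a ((x : N ≃ᵃ[ℝ] N) u) = 0} := by
        rwa [Set.mem_ofPred_eq, apply_inv_apply]
      rw [h1, ← h2, Set.mem_ofPred_eq, apply_inv_apply] at hmem
      exact hp2.ne' hmem
  rw [hg, ← mul_assoc, mul_inv_eq_one] at hsg
  exact hsg.symm

omit [Finite ι] [P.IsCrystallographic] [P.IsReduced] in
lemma affRoot_zero (a : ι × ℤ) : affRoot P a 0 = a.2 := by simp [affRoot]

/-- The steps of the affine Grassmannian walk from an alcove in the fundamental chamber,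
in terms of the simple affine roots. -/
lemma grassStep_iff (hθ : IsHighestRoot b θ) (hv : v ∈ fundAlcove b θ) {x y : affineWeyl P}
    (hx : alcove b θ x ⊆ fundChamber b) :
    GrassStep b θ x y ↔ ∃ a, IsSimpleAff b θ a ∧ y = affReflection P a * x ∧
      P.root' a.1 ((proj P x : N ≃ₗ[ℝ] N) v) < 0 := by
  constructor
  · rintro ⟨H, hH, hHx, hy⟩
    obtain ⟨a, ha, rfl⟩ := exists_eq_affReflection_mul hθ hv hH
    refine ⟨a, ha, rfl, ?_⟩
    rw [separating_affReflection_mul hθ hv x ha, Set.singleton_eq_singleton_iff] at hH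
    subst hH
    obtain ⟨⟨i, k⟩, hi⟩ := exists_affRoot_apply x a
    rw [root'_proj_of_affRoot hi]
    by_contra! hcon
    have hpos : b.IsPos i :=
      (isPos_iff_root'_pos hv.1).2 (lt_of_le_of_ne hcon (root'_ne_zero hv.1 i).symm)
    -- `α_i + k` is negative on the new alcove, which lies in the chamber, where `α_i > 0`. Hence
    -- `α_i + k` is negative on `A°` and positive on `A_x`, so the wall was crossed before.
    have hk : k < 0 := by
      have h1 := root'_pos_of_isPos hpos (hy (inv_apply_affReflection_mem_alcove hv x a))
      have h2 := hi (((x⁻¹ : affineWeyl P) : N ≃ᵃ[ℝ] N) ((affReflection P a : N ≃ᵃ[ℝ] N) v))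
      rw [apply_inv_apply, affRoot_affReflection_self] at h2
      have h3 := mem_fundAlcove_iff.1 hv a ha
      simp only [affRoot] at h2 h3
      have : (k : ℝ) < 0 := by linarith
      exact_mod_cast this
    refine hHx (mem_separating.2 ⟨(P.reflectionPerm i i, -k), ?_, fun u hu ↦ ?_, fun u hu ↦ ?_⟩)
    · ext u
      rw [Set.mem_ofPred_eq, Set.mem_ofPred_eq, affRoot_neg, neg_eq_zero, hi]
    · exact (affRoot_pos_iff hθ hu _).2 (.inl (by dsimp only; omega))
    · rw [affRoot_neg, ← hi, neg_lt_zero]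
      exact mem_fundAlcove_iff.1 hu a ha
  · rintro ⟨a, ha, rfl, hneg⟩
    have hH := separating_affReflection_mul hθ hv x ha
    obtain ⟨⟨i, k⟩, hi⟩ := exists_affRoot_apply x a
    rw [root'_proj_of_affRoot hi] at hneg
    have hxa : ∀ u ∈ alcove b θ x, 0 < affRoot P (i, k) u := fun u hu ↦ by
      rw [← hi]
      exact mem_fundAlcove_iff.1 hu a ha
    have hxv := inv_apply_mem_alcove hv x
    -- `α_i` is negative on the whole chamber, in particular on `A_x`, where `α_i + k > 0`.
    have hk : 0 < k := by
      have h1 : ¬ 0 < P.root' i (((x⁻¹ : affineWeyl P) : N ≃ᵃ[ℝ] N) v) := fun h ↦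
        hneg.not_gt ((isPos_iff_root'_pos hv.1).1 ((isPos_iff_root'_pos (hx hxv)).2 h))
      have h2 := hxa _ hxv
      rw [affRoot] at h2
      have : (0 : ℝ) < k := by linarith
      exact_mod_cast this
    have hvk : 0 < affRoot P (i, k) v := (affRoot_pos_iff hθ hv _).2 (.inl hk)
    refine ⟨_, hH, fun hmem ↦ ?_, fun u hu j hj ↦ ?_⟩
    · obtain ⟨c, hc, h1, h2⟩ := mem_separating.1 hmem
      replace h1 := h1 v hv
      replace h2 := h2 _ hxv
      have h3 := hxa _ hxv
      set u := ((x⁻¹ : affineWeyl P) : N ≃ᵃ[ℝ] N) v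
      -- The zero of `c` on the segment from `v` to `u`. It would lie on the wall `α_i + k = 0`, yet
      -- `α_i + k` is positive at both ends.
      set t : ℝ := affRoot P c v / (affRoot P c v - affRoot P c u) with ht
      have hd : 0 < affRoot P c v - affRoot P c u := by linarith
      have ht0 : 0 < t := div_pos h1 hd
      have ht1 : t < 1 := by rw [ht, div_lt_one hd]; linarith
      have hmem' : (1 - t) • v + t • u ∈ {w | affRoot P c w = 0} := by
        rw [Set.mem_ofPred_eq, affRoot_combo, ht]
        field_simp
        ring
      rw [← hc, Set.mem_ofPred_eq, hi, affRoot_combo] at hmem'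
      have := mul_pos (sub_pos.2 ht1) hvk
      have := mul_pos ht0 h3
      linarith
    · by_contra! hcon
      -- Leaving the chamber would make the linear hyperplane `α_j = 0` the one wall crossed. It
      -- contains the origin, where `α_i + k` has the value `k > 0`.
      have hmem : {w | affRoot P (j, 0) w = 0} ∈
          separating P (alcove b θ x) (alcove b θ (affReflection P a * x)) := by
        refine mem_separating.2 ⟨(j, 0), rfl, fun w hw ↦ ?_, fun w hw ↦ ?_⟩
        · simpa [affRoot] using hx hw j hj
        · exact affRoot_neg_of_alcove hθ hu hw (by simpa [affRoot] using hcon)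
      rw [hH, Set.mem_singleton_iff] at hmem
      have h0 : (0 : N) ∈ {w | affRoot P (j, 0) w = 0} := by simp [affRoot_zero]
      rw [hmem, Set.mem_ofPred_eq, hi, affRoot_zero] at h0
      norm_cast at h0
      exact hk.ne' h0

end Steps

end AffWalk

namespace AffWalk

/-! ### Delayed transition matrices and projections of Markov chains -/

section Lumping

variable {S T : Type*}

lemma delayedMatrix_self (r : ℕ) (step : S → S → Prop) (x : S) :
    delayedMatrix r step x x = 1 - ({z | z ≠ x ∧ step x z}.ncard : ℝ) / r := if_pos rfl

lemma delayedMatrix_of_step {r : ℕ} {step : S → S → Prop} {x y : S} (hne : y ≠ x)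
    (h : step x y) : delayedMatrix r step x y = 1 / r := by
  rw [delayedMatrix, if_neg hne, if_pos h]

lemma delayedMatrix_of_not_step {r : ℕ} {step : S → S → Prop} {x y : S} (hne : y ≠ x)
    (h : ¬ step x y) : delayedMatrix r step x y = 0 := by
  rw [delayedMatrix, if_neg hne, if_neg h]

lemma isStochastic_delayedMatrix {r : ℕ} (hr : 0 < r) {step : S → S → Prop}
    (hfin : ∀ x, {z | step x z}.Finite) (hcard : ∀ x, {z | step x z}.ncard ≤ r) :
    IsStochastic (delayedMatrix r step) := by
  classical
  have hr' : (0 : ℝ) < r := by exact_mod_cast hr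
  have hsub : ∀ x, {z | z ≠ x ∧ step x z} ⊆ {z | step x z} := fun x z hz ↦ hz.2
  refine ⟨fun x y ↦ ?_, fun x ↦ ?_⟩
  · rcases eq_or_ne y x with rfl | hne
    · rw [delayedMatrix_self, sub_nonneg, div_le_one hr']
      exact_mod_cast (Set.ncard_le_ncard (hsub y) (hfin y)).trans (hcard y)
    · by_cases h : step x y
      · rw [delayedMatrix_of_step hne h]; positivity
      · rw [delayedMatrix_of_not_step hne h]
  · have hf := (hfin x).subset (hsub x)
    have hx : x ∉ hf.toFinset := by simp
    have hsum : ∑ z ∈ insert x hf.toFinset, delayedMatrix r step x z = 1 := by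
      rw [Finset.sum_insert hx, delayedMatrix_self, Finset.sum_congr rfl (g := fun _ ↦ (1 : ℝ) / r),
        Finset.sum_const, Set.ncard_eq_toFinset_card _ hf, nsmul_eq_mul]
      · ring
      · intro z hz
        obtain ⟨h1, h2⟩ := hf.mem_toFinset.1 hz
        exact delayedMatrix_of_step h1 h2
    rw [← hsum]
    refine hasSum_sum_of_ne_finset_zero fun z hz ↦ ?_
    simp only [Finset.mem_insert, not_or, Set.Finite.mem_toFinset, Set.mem_ofPred_eq, not_and] at hz
    exact delayedMatrix_of_not_step hz.1 (hz.2 hz.1)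

open scoped Classical in
-- By the bijection each fibre sum has at most one nonzero term. The holding probabilities agree
-- because both states have equally many steps; `hself` ensures that no step from `x` stays in the
-- fibre of `f x`.
lemma hasSum_delayedMatrix_fiber (r : ℕ) {step : S → S → Prop} {step' : T → T → Prop} {f : S → T}
    {x : S} (hbij : Set.BijOn f {y | step x y} {v | step' (f x) v}) (hself : ¬ step' (f x) (f x))
    (v : T) :
    HasSum (fun y ↦ if f y = v then delayedMatrix r step x y else 0)
      (delayedMatrix r step' (f x) v) := by
  have hmaps : ∀ {y}, step x y → step' (f x) (f y) := fun h ↦ hbij.mapsTo h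
  have hcard : {z | z ≠ x ∧ step x z}.ncard = {v | v ≠ f x ∧ step' (f x) v}.ncard := by
    have h1 : {z | z ≠ x ∧ step x z} = {z | step x z} :=
      Set.ext fun z ↦ and_iff_right_of_imp fun h he ↦ hself (hmaps (he ▸ h))
    have h2 : {v | v ≠ f x ∧ step' (f x) v} = {v | step' (f x) v} :=
      Set.ext fun z ↦ and_iff_right_of_imp fun h he ↦ hself (he ▸ h)
    rw [h1, h2, ← hbij.image_eq, hbij.injOn.ncard_image]
  by_cases hv : v = f x
  · subst hv
    have := hasSum_single (f := fun y ↦ if f y = f x then delayedMatrix r step x y else 0) x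
      fun y hy ↦ ?_
    · simpa [delayedMatrix_self, hcard] using this
    · split_ifs with h
      · exact delayedMatrix_of_not_step hy fun hs ↦ hself (h ▸ hmaps hs)
      · rfl
  · by_cases hs : step' (f x) v
    · obtain ⟨y, hy, rfl⟩ := hbij.surjOn hs
      have hyx : y ≠ x := by rintro rfl; exact hv rfl
      have := hasSum_single (f := fun z ↦ if f z = f y then delayedMatrix r step x z else 0) y
        fun z hz ↦ ?_
      · rw [if_pos rfl, delayedMatrix_of_step hyx hy] at this
        rwa [delayedMatrix_of_step hv hs]
      · split_ifs with h
        · refine delayedMatrix_of_not_step (by rintro rfl; exact hv h.symm) fun hs' ↦ ?_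
          exact hz (hbij.injOn hs' hy h)
        · rfl
    · rw [delayedMatrix_of_not_step hv hs]
      convert! hasSum_zero with y
      split_ifs with h
      · subst h
        exact delayedMatrix_of_not_step (by rintro rfl; exact hv rfl) fun hs' ↦ hs (hmaps hs')
      · rfl

variable {Ω : Type*} [MeasurableSpace Ω] {μ : Measure Ω}

lemma hasSum_measureReal_inter_fiber {K : Type*} [Countable K] [IsFiniteMeasure μ] {g : Ω → K}
    (hg : ∀ k, MeasurableSet (g ⁻¹' {k})) {E : Set Ω} (hE : MeasurableSet E) :
    HasSum (fun k ↦ μ.real (E ∩ g ⁻¹' {k})) (μ.real E) := by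
  have hU : μ E = ∑' k, μ (E ∩ g ⁻¹' {k}) := by
    rw [← measure_iUnion _ fun k ↦ hE.inter (hg k), ← Set.inter_iUnion,
      ← Set.preimage_iUnion, Set.iUnion_of_singleton, Set.preimage_univ, Set.inter_univ]
    intro k k' hk
    exact ((Set.disjoint_singleton.2 hk).preimage g).mono Set.inter_subset_right
      Set.inter_subset_right
  have hne : ∑' k, μ (E ∩ g ⁻¹' {k}) ≠ ⊤ := hU ▸ measure_ne_top μ E
  rw [measureReal_def, hU, ENNReal.tsum_toReal_eq fun k ↦ measure_ne_top μ _]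
  exact (ENNReal.summable_toReal hne).hasSum

/-- Lets the lumping condition be required on the absorbing set `G` only. -/
lemma IsMarkovChain.measureReal_path_eq_zero [IsFiniteMeasure μ] {X : ℕ → Ω → S} {x₀ : S}
    {p : S → S → ℝ} (h : IsMarkovChain μ X x₀ p) {G : Set S} (h0 : x₀ ∈ G)
    (hG : ∀ x ∈ G, ∀ y, p x y ≠ 0 → y ∈ G) (c : ℕ → S) (n : ℕ) (hn : c n ∉ G) :
    μ.real {ω | ∀ j ≤ n, X j ω = c j} = 0 := by
  induction n with
  | zero =>
    rw [measureReal_eq_zero_iff]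
    refine measure_mono_null (fun ω hω ↦ ?_) (ae_iff.1 h.init)
    intro h1
    exact hn (by rw [← hω 0 le_rfl, h1]; exact h0)
  | succ n ih =>
    rw [h.step]
    by_cases hc : c n ∈ G
    · rw [mul_eq_zero]
      right
      by_contra hp
      exact hn (hG _ hc _ hp)
    · rw [ih hc, zero_mul]

/-- A Markov chain whose transition probabilities into the fibres of `f` depend only on the image
under `f`, on an absorbing set of states, projects to a Markov chain. -/
theorem IsMarkovChain.map [Countable S] [IsFiniteMeasure μ] {X : ℕ → Ω → S} {x₀ : S}
    {p : S → S → ℝ} (h : IsMarkovChain μ X x₀ p) {G : Set S} (h0 : x₀ ∈ G)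
    (hG : ∀ x ∈ G, ∀ y, p x y ≠ 0 → y ∈ G) (f : S → T) {q : T → T → ℝ}
    (hq : open scoped Classical in ∀ x ∈ G, ∀ v,
      HasSum (fun y ↦ if f y = v then p x y else 0) (q (f x) v)) :
    IsMarkovChain μ (fun n ω ↦ f (X n ω)) (f x₀) q := by
  classical
  have hmeas : ∀ n (s : Set S), MeasurableSet (X n ⁻¹' s) := fun n s ↦
    h.measurable n (t := s) trivial
  have hcyl : ∀ n (s : ℕ → Set S), MeasurableSet {ω | ∀ j ≤ n, X j ω ∈ s j} := fun n s ↦ by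
    have : {ω | ∀ j ≤ n, X j ω ∈ s j} = ⋂ j, ⋂ _ : j ≤ n, X j ⁻¹' s j := by
      ext ω; simp
    rw [this]
    exact .iInter fun j ↦ .iInter fun _ ↦ hmeas j _
  refine ⟨fun n s _ ↦ hmeas n (f ⁻¹' s), h.init.mono fun ω hω ↦ congrArg f hω, fun n a ↦ ?_⟩
  set E : Set Ω := {ω | ∀ j ≤ n, f (X j ω) = a j} with hE
  set E' : Set Ω := {ω | ∀ j ≤ n + 1, f (X j ω) = a j} with hE'
  have hEm : MeasurableSet E := hcyl n fun j ↦ f ⁻¹' {a j}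
  have hE'm : MeasurableSet E' := hcyl (n + 1) fun j ↦ f ⁻¹' {a j}
  let g : Ω → Fin (n + 1) → S := fun ω j ↦ X j ω
  have hg : ∀ β, MeasurableSet (g ⁻¹' {β}) := fun β ↦ by
    have : g ⁻¹' {β} = ⋂ j : Fin (n + 1), X j ⁻¹' {β j} := by
      ext ω; simp [g, funext_iff]
    rw [this]
    exact .iInter fun j ↦ hmeas _ _
  -- The lumped event does not determine the state at time `n`, so it is split by the full history
  -- `β`. The histories are countably many, and the factor `q (a n) (a (n + 1))` does not depend on
  -- `β`.
  have key : ∀ β, μ.real (E' ∩ g ⁻¹' {β}) = μ.real (E ∩ g ⁻¹' {β}) * q (a n) (a (n + 1)) := by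
    intro β
    by_cases hβ : ∀ j, f (β j) = a j
    · have hgE : E ∩ g ⁻¹' {β} = g ⁻¹' {β} := by
        refine Set.inter_eq_right.2 fun ω hω j hj ↦ ?_
        have := congrFun hω ⟨j, Nat.lt_succ_of_le hj⟩
        rw [← hβ ⟨j, Nat.lt_succ_of_le hj⟩, ← this]
      have hpath : ∀ y, ∃ c : ℕ → S,
          g ⁻¹' {β} = {ω | ∀ j ≤ n, X j ω = c j} ∧
          g ⁻¹' {β} ∩ X (n + 1) ⁻¹' {y} = {ω | ∀ j ≤ n + 1, X j ω = c j} ∧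
          c n = β (Fin.last n) ∧ c (n + 1) = y := by
        intro y
        -- The history `β` prolonged by `y`; values after time `n + 1` are irrelevant.
        let c : ℕ → S := fun j ↦ if hj : j < n + 1 then β ⟨j, hj⟩ else y
        have h1 : g ⁻¹' {β} = {ω | ∀ j ≤ n, X j ω = c j} := by
          ext ω
          constructor
          · intro hω j hj
            rw [show c j = β ⟨j, Nat.lt_succ_of_le hj⟩ from dif_pos _]
            exact congrFun hω ⟨j, Nat.lt_succ_of_le hj⟩
          · intro hω
            funext j
            have := hω j (Nat.le_of_lt_succ j.2)
            rw [show c j = β j from dif_pos j.2] at this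
            exact this
        have h2 : c (n + 1) = y := dif_neg (lt_irrefl _)
        refine ⟨c, h1, ?_, dif_pos (Nat.lt_succ_self n), h2⟩
        rw [h1]
        ext ω
        simp only [Set.mem_inter_iff, Set.mem_ofPred_eq, Set.mem_preimage, Set.mem_singleton_iff,
          Nat.le_succ_iff, or_imp, forall_and, forall_eq, h2]
      have hstep : ∀ y, μ.real (E' ∩ g ⁻¹' {β} ∩ X (n + 1) ⁻¹' {y}) =
          μ.real (g ⁻¹' {β}) * if f y = a (n + 1) then p (β (Fin.last n)) y else 0 := by
        intro y
        obtain ⟨c, h1, h2, h3, h4⟩ := hpath y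
        split_ifs with hy
        · have h5 : E' ∩ g ⁻¹' {β} ∩ X (n + 1) ⁻¹' {y} = g ⁻¹' {β} ∩ X (n + 1) ⁻¹' {y} := by
            rw [Set.inter_assoc]
            refine Set.inter_eq_right.2 fun ω hω j hj ↦ ?_
            rcases Nat.le_succ_iff.1 hj with hj | rfl
            · exact (hgE.ge hω.1).1 j hj
            · rw [show X (n + 1) ω = y from hω.2, hy]
          rw [h5, h2, h.step, h1, h3, h4]
        · have h5 : E' ∩ g ⁻¹' {β} ∩ X (n + 1) ⁻¹' {y} = ∅ := by
            refine Set.eq_empty_of_forall_notMem fun ω hω ↦ hy ?_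
            rw [← hω.1.1 (n + 1) le_rfl, show X (n + 1) ω = y from hω.2]
          rw [h5, measureReal_empty, mul_zero]
      have hs := hasSum_measureReal_inter_fiber (μ := μ) (g := X (n + 1))
        (fun y ↦ hmeas (n + 1) {y}) (hE'm.inter (hg β))
      simp only [hstep] at hs
      rw [hgE]
      by_cases hβG : β (Fin.last n) ∈ G
      · have hq' := (hq _ hβG (a (n + 1))).mul_left (μ.real (g ⁻¹' {β}))
        rw [hβ] at hq'
        exact hs.unique hq'
      · obtain ⟨c, h1, -, h3, -⟩ := hpath x₀
        have hz : μ.real (g ⁻¹' {β}) = 0 := by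
          rw [h1]
          exact h.measureReal_path_eq_zero h0 hG _ n (h3 ▸ hβG)
        simp only [hz, zero_mul] at hs ⊢
        exact hs.unique hasSum_zero
    · push Not at hβ
      obtain ⟨j, hj⟩ := hβ
      have h1 : ∀ ω ∈ g ⁻¹' {β}, f (X j ω) ≠ a j := fun ω hω he ↦
        hj (by rw [← he, ← congrFun hω j])
      have hjn := Nat.le_of_lt_succ j.2
      have h2 : E ∩ g ⁻¹' {β} = ∅ :=
        Set.eq_empty_of_forall_notMem fun ω hω ↦ h1 ω hω.2 (hω.1 j hjn)
      have h3 : E' ∩ g ⁻¹' {β} = ∅ :=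
        Set.eq_empty_of_forall_notMem fun ω hω ↦ h1 ω hω.2 (hω.1 j (hjn.trans n.le_succ))
      rw [h2, h3, measureReal_empty, zero_mul]
  have hs' := hasSum_measureReal_inter_fiber (μ := μ) hg hE'm
  simp only [key] at hs'
  exact hs'.unique ((hasSum_measureReal_inter_fiber hg hEm).mul_right _)

end Lumping

end AffWalk

namespace AffWalk

/-! ### The projection is a bijection on steps -/

section Projection

variable {ι M N : Type*} [AddCommGroup M] [Module ℝ M] [AddCommGroup N] [Module ℝ N]
  {P : RootPairing ι ℝ M N} {b : P.Base} {θ : ι} {v : N}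

/-- A quotient of a free group on countably many generators; countability allows summation over
histories. -/
lemma countable_affineWeyl [Countable ι] (P : RootPairing ι ℝ M N) :
    Countable (affineWeyl P) := by
  have h : {g | ∃ (i : ι) (k : ℤ), g = affineRefl P i k} =
      Set.range fun a : ι × ℤ ↦ affineRefl P a.1 a.2 := by
    ext g
    simp [eq_comm]
  rw [affineWeyl, h, ← FreeGroup.range_lift_eq_closure]
  exact (MonoidHom.rangeRestrict_surjective _).countable

lemma finite_setOf_isSimpleAff (b : P.Base) (θ : ι) : {a | IsSimpleAff b θ a}.Finite ∧
    {a | IsSimpleAff b θ a}.ncard ≤ b.support.card + 1 := by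
  classical
  have h : {a | IsSimpleAff b θ a} ⊆
      ↑(insert (P.reflectionPerm θ θ, (1 : ℤ)) (b.support.image fun i ↦ (i, (0 : ℤ)))) := by
    rintro ⟨i, k⟩ (⟨hi, hk⟩ | h)
    · dsimp only at hi hk
      simp [hi, hk]
    · simp [h]
  refine ⟨(Finset.finite_toSet _).subset h, ?_⟩
  refine (Set.ncard_le_ncard h (Finset.finite_toSet _)).trans ?_
  rw [Set.ncard_coe_finset]
  exact (Finset.card_insert_le _ _).trans (Nat.succ_le_succ Finset.card_image_le)

/-- There is at most one step per simple affine root, hence at most `r`, which makes the holding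
probability non-negative. -/
lemma finite_steps {S : Type*} (F : ι × ℤ → S) {s : Set S}
    (hs : s ⊆ F '' {a | IsSimpleAff b θ a}) :
    s.Finite ∧ s.ncard ≤ b.support.card + 1 := by
  obtain ⟨hf, hc⟩ := finite_setOf_isSimpleAff b θ
  exact ⟨(hf.image F).subset hs,
    (Set.ncard_le_ncard hs (hf.image F)).trans ((Set.ncard_image_le hf).trans hc)⟩

lemma not_weylStep_self (w : weyl P) : ¬ WeylStep b θ w w := by
  rintro (⟨i, -, -, h⟩ | ⟨-, h⟩) <;> exact lt_irrefl _ h.length_lt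

lemma weylStep_subset (w : weyl P) : {u | WeylStep b θ w u} ⊆
    (fun a ↦ refl P a.1 * w) '' {a : ι × ℤ | IsSimpleAff b θ a} := by
  rintro u (⟨i, hi, rfl, -⟩ | ⟨rfl, -⟩)
  · exact ⟨(i, 0), .inl ⟨hi, rfl⟩, rfl⟩
  · exact ⟨_, .inr rfl, by dsimp only; rw [refl_reflectionPerm_self]⟩

/-- Equal reflections have proportional coroots and hence proportional roots; reducedness leaves
only the factors `±1`. -/
lemma root_eq_or_eq_neg_of_refl_eq [P.IsReduced] {i j : ι} (h : refl P i = refl P j) :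
    i = j ∨ P.root i = -P.root j := by
  have h' : ∀ v, P.root' i v • P.coroot i = P.root' j v • P.coroot j := fun v ↦ by
    have := LinearEquiv.congr_fun (congrArg Subtype.val h) v
    exact sub_right_inj.1 this
  have hij : P.coroot i = (P.root' j (P.coroot i) / 2) • P.coroot j := by
    have := h' (P.coroot i)
    rw [RootPairing.root'_coroot_eq_pairing, RootPairing.pairing_same] at this
    rw [div_eq_inv_mul, mul_smul, ← this, smul_smul]
    norm_num
  set t := P.root' j (P.coroot i) / 2
  have hroot : t • P.root i = P.root j := by
    refine (LinearMap.IsPerfPair.bijective_left P.toLinearMap).injective (LinearMap.ext fun v ↦ ?_)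
    have := h' v
    rw [hij, smul_smul] at this
    have := smul_left_injective ℝ (P.ne_zero' j) this
    rw [map_smul, LinearMap.smul_apply, smul_eq_mul, mul_comm]
    exact this
  by_contra! hne
  have hli := RootPairing.IsReduced.linearIndependent P hne.1 hne.2
  rw [LinearIndependent.pair_iff] at hli
  have := (hli t (-1) (by rw [hroot]; simp)).2
  norm_num at this

variable [Finite ι] [P.IsCrystallographic] [P.IsReduced]

omit [Finite ι] [P.IsCrystallographic] [P.IsReduced] in
-- The gradient `-θ` is negative on the chamber, so it is not a simple root.
lemma IsSimpleAff.ext (hθ : IsHighestRoot b θ) (hv : v ∈ fundChamber b) {a c : ι × ℤ}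
    (ha : IsSimpleAff b θ a) (hc : IsSimpleAff b θ c) (h : a.1 = c.1) : a = c := by
  have hnot : P.reflectionPerm θ θ ∉ b.support := fun hmem ↦ by
    have h1 : 0 < P.root' (P.reflectionPerm θ θ) v := hv _ hmem
    rw [root'_reflectionPerm_self] at h1
    linarith [hθ.root'_pos hv]
  rcases ha with ⟨ha, ha'⟩ | rfl <;> rcases hc with ⟨hc, hc'⟩ | rfl
  · exact Prod.ext h (ha'.trans hc'.symm)
  · exact absurd (by simpa only [h] using ha) hnot
  · exact absurd (by simpa only [← h] using hc) hnot
  · rfl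

lemma bijOn_proj (hθ : IsHighestRoot b θ) (hv : v ∈ fundAlcove b θ) {x : affineWeyl P}
    (hx : alcove b θ x ⊆ fundChamber b) :
    Set.BijOn (proj P) {y | GrassStep b θ x y} {u | WeylStep b θ (proj P x) u} := by
  refine ⟨fun y hy ↦ ?_, fun y hy z hz hyz ↦ ?_, fun u hu ↦ ?_⟩
  · obtain ⟨a, ha, rfl, hneg⟩ := (grassStep_iff hθ hv hx).1 hy
    exact (weylStep_iff hθ hv.1).2 ⟨a, ha, by rw [map_mul, proj_affReflection], hneg⟩
  · obtain ⟨a, ha, rfl, hneg⟩ := (grassStep_iff hθ hv hx).1 hy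
    obtain ⟨c, hc, rfl, hneg'⟩ := (grassStep_iff hθ hv hx).1 hz
    rw [map_mul, map_mul, proj_affReflection, proj_affReflection, mul_left_inj] at hyz
    -- Distinct simple affine reflections can share a linear part (in rank one, `α_1 = θ`). Their
    -- gradients are then opposite, so they cannot both be negative at the same point.
    rcases root_eq_or_eq_neg_of_refl_eq hyz with h | h
    · rw [IsSimpleAff.ext hθ hv.1 ha hc h]
    · rw [RootPairing.root', h, map_neg, LinearMap.neg_apply] at hneg
      exact absurd hneg' (neg_neg_iff_pos.1 hneg).not_gt
  · obtain ⟨a, ha, rfl, hneg⟩ := (weylStep_iff hθ hv.1).1 hu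
    exact ⟨_, (grassStep_iff hθ hv hx).2 ⟨a, ha, rfl, hneg⟩, by rw [map_mul, proj_affReflection]⟩

lemma grassStep_subset (hθ : IsHighestRoot b θ) (hv : v ∈ fundAlcove b θ) (x : affineWeyl P) :
    {y | GrassStep b θ x y} ⊆
      (fun a ↦ affReflection P a * x) '' {a : ι × ℤ | IsSimpleAff b θ a} := by
  rintro y ⟨H, hH, -⟩
  obtain ⟨a, ha, rfl⟩ := exists_eq_affReflection_mul hθ hv hH
  exact ⟨a, ha, rfl⟩

end Projection

end AffWalk

theorem proposition3p3 {ι M N : Type*} [Finite ι] [AddCommGroup M] [Module ℝ M]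
    [AddCommGroup N] [Module ℝ N] (P : RootPairing ι ℝ M N) [P.IsRootSystem]
    [P.IsCrystallographic] [P.IsReduced] [P.IsIrreducible] (b : P.Base) (θ : ι)
    (hθ : AffWalk.IsHighestRoot b θ) :
    AffWalk.IsStochastic (AffWalk.grassMatrix b θ) ∧
    AffWalk.IsStochastic (AffWalk.weylMatrix b θ) ∧
    ∀ (Ω : Type*) [MeasurableSpace Ω] (μ : MeasureTheory.Measure Ω)
      [MeasureTheory.IsProbabilityMeasure μ] (Y : ℕ → Ω → AffWalk.affineWeyl P),
      AffWalk.IsMarkovChain μ Y 1 (AffWalk.grassMatrix b θ) →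
      AffWalk.IsMarkovChain μ (fun n ω ↦ AffWalk.proj P (Y n ω)) 1
        (AffWalk.weylMatrix b θ) := by
  obtain ⟨v, hv⟩ := AffWalk.exists_mem_fundAlcove hθ
  have hr : 0 < b.support.card + 1 := Nat.succ_pos _
  refine ⟨AffWalk.isStochastic_delayedMatrix hr
      (fun x ↦ (AffWalk.finite_steps _ (AffWalk.grassStep_subset hθ hv x)).1)
      (fun x ↦ (AffWalk.finite_steps _ (AffWalk.grassStep_subset hθ hv x)).2),
    AffWalk.isStochastic_delayedMatrix hr
      (fun w ↦ (AffWalk.finite_steps _ (AffWalk.weylStep_subset w)).1)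
      (fun w ↦ (AffWalk.finite_steps _ (AffWalk.weylStep_subset w)).2), ?_⟩
  intro Ω _ μ _ Y hY
  have := AffWalk.countable_affineWeyl P
  rw [← map_one (AffWalk.proj P)]
  -- The alcoves in the fundamental chamber form an absorbing set, since every step ends there by
  -- definition.
  refine hY.map (G := {x | AffWalk.alcove b θ x ⊆ AffWalk.fundChamber b}) ?_ ?_
    (AffWalk.proj P) ?_
  · exact fun u hu ↦ hu.1
  · intro x hx y hxy
    by_cases h : y = x
    · rwa [h]
    · by_cases hs : AffWalk.GrassStep b θ x y
      · obtain ⟨H, -, -, hy⟩ := hs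
        exact hy
      · exact absurd (AffWalk.delayedMatrix_of_not_step h hs) hxy
  · exact fun x hx u ↦ AffWalk.hasSum_delayedMatrix_fiber _ (AffWalk.bijOn_proj hθ hv hx)
      (AffWalk.not_weylStep_self _) u
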